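/- Fix $1\le p\le 2$, let $1/p+1/p'=1$, and let $v=(0,0,1)\in\mathbb{R}^3$. Let $\Gamma_0\subset\mathbb{R}^3$ be an open conic neighbourhood of $v$ and let $\varphi\in C^\infty(\Gamma_0)$ be positive and positively homogeneous of degree one. Suppose that $$\{\xi\in\Gamma_0:\varphi(\xi)=1\}=\{(x_1,x_2,1+\phi(x_1,x_2)):(x_1,x_2)\in U\},$$ where $U\subset\mathbb{R}^2$ is an open neighbourhood of the origin and $\phi\in C^\infty(U)$ is real-valued with $\phi(0)=0$, $\nabla\phi(0)=0$. Let $F$ be the Fourier transform, $Fu(\xi)=(2\pi)^{-3/2}\int_{\mathbb{R}^3}e^{i\xi\cdot x}u(x)\,dx$. For an open cone $\Gamma$ let $S^{-k}_0(\Gamma)$ be the space of classical (polyhomogeneous) symbols $a\in C^\infty(\mathbb{R}^3)$ of order $-k$ with support in $\Gamma$. Define $k_p(v)$ as the infimum of all $k>0$ for which there is an open conic neighbourhood $\Gamma$ of $v$, on which $\varphi$ is smooth, such that for every $a\in S^{-k}_0(\Gamma)$ the operator $F^{-1}[e^{i\varphi}a]F$ (defined on Schwartz functions) is bounded from $L^p(\mathbb{R}^3)$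 to $L^{p'}(\mathbb{R}^3)$. For a smooth function $f$ near $0\in\mathbb{R}^2$ with $f(0)=0$, $\nabla f(0)=0$, the Newton polyhedron $\mathcal N(f)$ is the convex hull of the union of the octants $\alpha+\mathbb{R}_+^2$ over all $\alpha\in\mathbb{Z}_+^2\setminus\{0\}$ with $\partial^\alpha f(0)\neq0$, and the Newton distance $d(f)$ is the coordinate $d$ of the point $(d,d)$ at which the line $t_1=t_2$ meets the boundary of $\mathcal N(f)$ (with $d(f)=\infty$ if $\mathcal N(f)=\emptyset$). Let $h_{lin}(\phi)=\sup_{T\in GL(\mathbb{R}^2)}d(\phi\circ T)\in[1,\infty]$ be the linear height of $\phi$. Then $$k_p(v)\ \ge\ \left(6-\frac{2}{h_{lin}(\phi)}\right)\left(\frac1p-\frac12\right),$$ where $2/h_{lin}(\phi)=0$ if $h_{lin}(\phi)=\infty$. -/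

import Mathlib

open MeasureTheory
open scoped ContDiff NNReal ENNReal

/-- The Euclidean plane. -/
abbrev Plane : Type := EuclideanSpace ℝ (Fin 2)

/-- The Euclidean space of dimension three. -/
abbrev Space : Type := EuclideanSpace ℝ (Fin 3)

noncomputable section

/-! ### Newton polyhedron, Newton distance, linear height -/

/-- The partial derivative of `f` in the `i`-th coordinate direction. -/
def partialDeriv (i : Fin 2) (f : Plane → ℝ) : Plane → ℝ :=
  fun x => fderiv ℝ f x (EuclideanSpace.single i 1)

/-- The Taylor coefficient at the origin, `∂₁^α₁ ∂₂^α₂ f (0) / (α₁! α₂!)`. -/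
def taylorCoeff (f : Plane → ℝ) (α : Fin 2 → ℕ) : ℝ :=
  ((partialDeriv 0)^[α 0] ((partialDeriv 1)^[α 1] f)) 0 /
    (((α 0).factorial : ℝ) * ((α 1).factorial : ℝ))

/-- The Taylor support of `f` at the origin. -/
def taylorSupport (f : Plane → ℝ) : Set (Fin 2 → ℕ) :=
  {α | α ≠ 0 ∧ taylorCoeff f α ≠ 0}

/-- The Newton polyhedron: the convex hull of the union of the octants `α + ℝ₊²`, where `α` runs
through the Taylor support. -/
def newtonPolyhedron (f : Plane → ℝ) : Set Plane :=
  convexHull ℝ (⋃ α ∈ taylorSupport f, {t : Plane | ∀ i, (α i : ℝ) ≤ t i})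

/-- The Newton distance: the coordinate `d` of the point `(d, d)` at which the bisectrix enters
the Newton polyhedron. It is `⊤` if the polyhedron is empty, that is, if `f - f 0` is flat. -/
def newtonDistance (f : Plane → ℝ) : EReal :=
  ⨅ d ∈ {d : ℝ | (!₂[d, d] : Plane) ∈ newtonPolyhedron f}, (d : EReal)

/-- The linear height: the supremum of the Newton distances of `f` in all linear coordinate
systems. -/
def linearHeight (f : Plane → ℝ) : EReal :=
  ⨆ T : Plane ≃L[ℝ] Plane, newtonDistance (f ∘ T)

/-! ### Symbols and convolution operators -/

/-- `Γ` is an open conic neighbourhood of `v`. -/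
def IsConicNhd (Γ : Set Space) (v : Space) : Prop :=
  IsOpen Γ ∧ v ∈ Γ ∧ ∀ ξ ∈ Γ, ∀ t : ℝ, 0 < t → t • ξ ∈ Γ

/-- Classical (polyhomogeneous) symbols of order `m` with constant coefficients: smooth functions
`a` with an asymptotic expansion `a ~ ∑ⱼ bⱼ` for large `ξ`, where `bⱼ` is smooth away from the
origin and positively homogeneous of degree `m - j`. -/
def IsClassicalSymbol (m : ℝ) (a : Space → ℂ) : Prop :=
  ContDiff ℝ ∞ a ∧
  ∃ b : ℕ → Space → ℂ,
    (∀ j, ContDiffOn ℝ ∞ (b j) {0}ᶜ) ∧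
    (∀ j, ∀ ξ : Space, ξ ≠ 0 → ∀ t : ℝ, 0 < t →
      b j (t • ξ) = ((t ^ (m - (j : ℝ)) : ℝ) : ℂ) * b j ξ) ∧
    ∀ N n : ℕ, ∃ C : ℝ, ∀ ξ : Space, 1 ≤ ‖ξ‖ →
      ‖iteratedFDeriv ℝ n (fun η => a η - ∑ j ∈ Finset.range N, b j η) ξ‖
        ≤ C * ‖ξ‖ ^ (m - (N : ℝ) - (n : ℝ))

/-- The space of classical symbols of order `m` with support in `Γ`. -/
def classicalSymbolsIn (m : ℝ) (Γ : Set Space) : Set (Space → ℂ) :=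
  {a | IsClassicalSymbol m a ∧ tsupport a ⊆ Γ}

/-- The Fourier transform `(2π)^(-3/2) ∫ e^{i ξ·x} u(x) dx`. -/
def fourierOp (u : Space → ℂ) (ξ : Space) : ℂ :=
  ((Real.sqrt ((2 * Real.pi) ^ 3))⁻¹ : ℝ) *
    ∫ x : Space, Complex.exp (Complex.I * (inner ℝ ξ x : ℝ)) * u x

/-- The inverse Fourier transform `(2π)^(-3/2) ∫ e^{-i ξ·x} w(ξ) dξ`. -/
def fourierOpInv (w : Space → ℂ) (x : Space) : ℂ :=
  ((Real.sqrt ((2 * Real.pi) ^ 3))⁻¹ : ℝ) *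
    ∫ ξ : Space, Complex.exp (-(Complex.I * (inner ℝ ξ x : ℝ))) * w ξ

/-- The operator `M = F⁻¹ [e^{iφ} a] F`. -/
def convOp (φ : Space → ℝ) (a : Space → ℂ) (u : Space → ℂ) : Space → ℂ :=
  fourierOpInv fun ξ => Complex.exp (Complex.I * (φ ξ : ℂ)) * a ξ * fourierOp u ξ

/-- `F⁻¹ [e^{iφ} a] F`, defined on Schwartz functions, is bounded from `L^p` to `L^{p'}`, where
`1/p + 1/p' = 1`. -/
def ConvOpBounded (φ : Space → ℝ) (a : Space → ℂ) (p : ℝ≥0∞) : Prop :=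
  ∃ C : ℝ≥0, ∀ u : SchwartzMap Space ℂ,
    eLpNorm (convOp φ a u) p.conjExponent volume ≤ C * eLpNorm u p volume

/-- The local critical exponent `k_p(v)`: the infimum of all `k > 0` for which there is an open
conic neighbourhood `Γ` of `v`, on which `φ` is smooth, such that `F⁻¹ [e^{iφ} a] F` is bounded
from `L^p` to `L^{p'}` for every classical symbol `a` of order `-k` with support in `Γ`. -/
def criticalExponent (φ : Space → ℝ) (v : Space) (p : ℝ) : EReal :=
  ⨅ k ∈ {k : ℝ | 0 < k ∧ ∃ Γ : Set Space, IsConicNhd Γ v ∧ ContDiffOn ℝ ∞ φ Γ ∧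
    ∀ a ∈ classicalSymbolsIn (-k) Γ, ConvOpBounded φ a (ENNReal.ofReal p)}, (k : EReal)

end

/-!
Fix `d < h_lin(ϕ)` and linear coordinates `T` with `d < d(ϕ ∘ T)`. A supporting line of the Newton
polyhedron above the point `(d, d)` gives weights `κ₀, κ₁ > 0` with `κ₀ + κ₁ < 1 / d` for which
`ϕ ∘ T = o(ρ)` on the box `|xᵢ| ≤ ρ ^ κᵢ`, by Taylor's formula. Write `λ = 1 / ρ`. Since `φ` is
homogeneous of degree one, on the `λ`-dilate of a box around `(0, 0, 1)` with sides `ρ ^ κ₀`,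
`ρ ^ κ₁`, `ρ ^ κ₂`, where `κ₀ + κ₁ + κ₂ = 1 / d`, the phase `φ` differs from the linear function
`ξ₂` by `O(1)`. The dilated box has volume comparable to `V = λ ^ (3 - 1 / d)`.

Test the operator, with a symbol elliptic near `(0, 0, 1)`, on a wave packet whose Fourier transform
lives on that box. There the oscillating factor is the character of a translation up to a harmless
error, so the output is bounded below by `λ ^ (-k) * V` on a dual box of volume `1 / V`. Comparing
`L^p'` and `L^p` norms gives `λ ^ (-k) * V ^ (2 / p - 1) ≤ C` as `λ → ∞`, hence
`k ≥ (6 - 2 / d) * (1 / p - 1 / 2)`.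
-/

open Filter Topology

/-! ### Supporting lines of the Newton polyhedron -/

section SupportingFunctional

variable {ι : Type*} [Fintype ι]

theorem exists_ne_zero_dotProduct_le_of_notMem {S : Set (ι → ℝ)} (hconv : Convex ℝ S)
    (hint : (interior S).Nonempty) {x : ι → ℝ} (hx : x ∉ S) :
    ∃ w : ι → ℝ, w ≠ 0 ∧ ∀ s ∈ S, w ⬝ᵥ x ≤ w ⬝ᵥ s := by
  classical
  obtain ⟨l, hl⟩ := geometric_hahn_banach_point_open hconv.interior isOpen_interior
    fun h => hx (interior_subset h)
  obtain ⟨w, hw⟩ : ∃ w : ι → ℝ, ∀ y, l y = w ⬝ᵥ y :=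
    ⟨_, fun y => (LinearMap.pi_apply_eq_sum_univ l.toLinearMap y).trans (dotProduct_comm y _)⟩
  refine ⟨w, ?_, fun s hs => ?_⟩
  · rintro rfl
    obtain ⟨s, hs⟩ := hint
    simpa [hw] using hl s hs
  · have hclosed : IsClosed {s | l x ≤ l s} := isClosed_le continuous_const l.continuous
    have hmem : s ∈ closure (interior S) := by
      rw [hconv.closure_interior_eq_closure_of_nonempty_interior hint]
      exact subset_closure hs
    simpa [hw] using hclosed.closure_subset_iff.2 (fun s hs => (hl s hs).le) hmem

theorem nonneg_of_isUpperSet_of_le_dotProduct {S : Set (ι → ℝ)} (hup : IsUpperSet S)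
    (hne : S.Nonempty) {w : ι → ℝ} {c : ℝ} (hw : ∀ s ∈ S, c ≤ w ⬝ᵥ s) : 0 ≤ w := by
  classical
  obtain ⟨s, hs⟩ := hne
  by_contra hneg
  obtain ⟨i, hi⟩ : ∃ i, w i < 0 := by simpa [Pi.le_def] using hneg
  obtain ⟨t, ht⟩ := exists_gt ((w ⬝ᵥ s - c) / -w i)
  have hpos : 0 ≤ max t 0 := le_max_right _ _
  have hmem : s + Pi.single i (max t 0) ∈ S :=
    hup (le_add_of_nonneg_right (Pi.single_nonneg.2 hpos)) hs
  have hlt := ht.trans_le (le_max_left t 0)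
  rw [div_lt_iff₀ (neg_pos.2 hi)] at hlt
  have := hw _ hmem
  rw [dotProduct_add, dotProduct_single] at this
  linarith

theorem exists_mem_stdSimplex_dotProduct_le_of_notMem [Nonempty ι] {S : Set (ι → ℝ)}
    (hconv : Convex ℝ S) (hup : IsUpperSet S) {x : ι → ℝ} (hx : x ∉ S) :
    ∃ w ∈ stdSimplex ℝ ι, ∀ s ∈ S, w ⬝ᵥ x ≤ w ⬝ᵥ s := by
  classical
  rcases S.eq_empty_or_nonempty with rfl | hne
  · exact ⟨_, single_mem_stdSimplex ℝ (Classical.arbitrary ι), by simp⟩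
  have hint : (interior S).Nonempty := by
    obtain ⟨s, hs⟩ := hne
    exact ⟨s + 1, hup.mem_interior_of_forall_lt (subset_closure hs) (by simp)⟩
  obtain ⟨w, hw, hwx⟩ := exists_ne_zero_dotProduct_le_of_notMem hconv hint hx
  have hw0 : 0 ≤ w := nonneg_of_isUpperSet_of_le_dotProduct hup hne hwx
  have hsum : 0 < ∑ i, w i :=
    Fintype.sum_pos (lt_of_le_of_ne hw0 hw.symm)
  refine ⟨(∑ i, w i)⁻¹ • w, ⟨fun i => ?_, ?_⟩, fun s hs => ?_⟩
  · exact mul_nonneg (inv_nonneg.2 hsum.le) (hw0 i)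
  · simp only [Pi.smul_apply, smul_eq_mul, ← Finset.mul_sum]
    exact inv_mul_cancel₀ hsum.ne'
  · simp only [smul_dotProduct, smul_eq_mul]
    exact mul_le_mul_of_nonneg_left (hwx s hs) (inv_nonneg.2 hsum.le)

end SupportingFunctional

theorem convex_newtonPolyhedron (f : Plane → ℝ) : Convex ℝ (newtonPolyhedron f) :=
  convex_convexHull ℝ _

theorem add_mem_newtonPolyhedron {f : Plane → ℝ} {s t : Plane} (hs : s ∈ newtonPolyhedron f)
    (ht : ∀ i, 0 ≤ t i) : s + t ∈ newtonPolyhedron f := by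
  have hconv : Convex ℝ {s | s + t ∈ newtonPolyhedron f} :=
    (convex_newtonPolyhedron f).translate_preimage_left t
  refine convexHull_min (fun s hs => ?_) hconv hs
  obtain ⟨α, hα, hs⟩ := Set.mem_iUnion₂.1 hs
  exact subset_convexHull ℝ _ <| Set.mem_biUnion hα fun i =>
    (hs i).trans (le_add_of_nonneg_right (ht i))

theorem natCast_mem_newtonPolyhedron {f : Plane → ℝ} {α : Fin 2 → ℕ} (hα : α ∈ taylorSupport f) :
    WithLp.toLp 2 (fun i => (α i : ℝ)) ∈ newtonPolyhedron f :=
  subset_convexHull ℝ _ (Set.mem_biUnion hα fun _ => le_rfl)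

theorem one_le_add_of_mem_newtonPolyhedron {f : Plane → ℝ} {t : Plane}
    (ht : t ∈ newtonPolyhedron f) : 1 ≤ t 0 + t 1 := by
  have hconv : Convex ℝ {t : Plane | 1 ≤ t 0 + t 1} :=
    convex_halfSpace_ge (f := fun t : Plane => t 0 + t 1)
      ⟨fun s t => by simp only [PiLp.add_apply]; ring, fun c t => by
        simp only [PiLp.smul_apply, smul_eq_mul]; ring⟩ 1
  refine convexHull_min (fun t ht => ?_) hconv ht
  obtain ⟨α, ⟨hα, -⟩, ht⟩ := Set.mem_iUnion₂.1 ht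
  have hα : 1 ≤ α 0 + α 1 := by
    by_contra! h
    exact hα (funext fun i => by fin_cases i <;> simp <;> omega)
  exact le_trans (mod_cast hα) (add_le_add (ht 0) (ht 1))

theorem half_le_newtonDistance (f : Plane → ℝ) : ((1 / 2 : ℝ) : EReal) ≤ newtonDistance f := by
  refine le_iInf₂ fun d hd => EReal.coe_le_coe_iff.2 ?_
  have h : 1 ≤ d + d := by simpa using one_le_add_of_mem_newtonPolyhedron hd
  linarith

theorem linearHeight_pos (f : Plane → ℝ) : 0 < linearHeight f :=
  (EReal.coe_pos.2 one_half_pos).trans_le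
    ((half_le_newtonDistance _).trans (le_iSup (fun T : Plane ≃L[ℝ] Plane => newtonDistance (f ∘ T))
      (ContinuousLinearEquiv.refl ℝ Plane)))

theorem diag_notMem_newtonPolyhedron {f : Plane → ℝ} {d : ℝ} (hd : d < newtonDistance f) :
    (!₂[d, d] : Plane) ∉ newtonPolyhedron f :=
  fun h => (iInf₂_le (f := fun (d : ℝ) _ => (d : EReal)) d h).not_gt hd

theorem exists_mem_stdSimplex_le_of_lt_newtonDistance {f : Plane → ℝ} {d : ℝ}
    (hd : d < newtonDistance f) :
    ∃ w ∈ stdSimplex ℝ (Fin 2), ∀ α ∈ taylorSupport f, d ≤ ∑ i, w i * α i := by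
  obtain ⟨w, hw, hwd⟩ := exists_mem_stdSimplex_dotProduct_le_of_notMem
    (S := WithLp.toLp 2 ⁻¹' newtonPolyhedron f) (x := ![d, d])
    ((convex_newtonPolyhedron f).linear_preimage
      (WithLp.linearEquiv 2 ℝ (Fin 2 → ℝ)).symm.toLinearMap)
    (fun s t hst hs => by
      have := add_mem_newtonPolyhedron (t := WithLp.toLp 2 (t - s)) hs
        fun i => sub_nonneg.2 (hst i)
      rwa [← WithLp.toLp_add, add_sub_cancel] at this)
    (diag_notMem_newtonPolyhedron hd)
  have hdiag : w ⬝ᵥ ![d, d] = d := by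
    have hsum := hw.2
    simp only [Fin.sum_univ_two] at hsum
    simp only [dotProduct, Fin.sum_univ_two, Matrix.cons_val_zero, Matrix.cons_val_one]
    rw [← add_mul, hsum, one_mul]
  exact ⟨w, hw, fun α hα => hdiag.symm.trans_le (hwd _ (natCast_mem_newtonPolyhedron hα))⟩

theorem exists_pos_weights_of_lt_newtonDistance {f : Plane → ℝ} {d : ℝ} (hd₀ : 0 < d)
    (hd : d < newtonDistance f) :
    ∃ κ : Fin 2 → ℝ, (∀ i, 0 < κ i) ∧ ∑ i, κ i = 1 / d ∧
      ∃ m > 1, ∀ α ∈ taylorSupport f, m ≤ ∑ i, κ i * α i := by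
  obtain ⟨e, hde, hef⟩ := EReal.lt_iff_exists_real_btwn.1 hd
  replace hde : d < e := EReal.coe_lt_coe_iff.1 hde
  have he : 0 < e := hd₀.trans hde
  obtain ⟨w, ⟨hw₀, hw₁⟩, hwe⟩ := exists_mem_stdSimplex_le_of_lt_newtonDistance hef
  set s : ℝ := (1 - d / e) / 2 with hs
  have hde' : d / e < 1 := (div_lt_one he).2 hde
  have hs₀ : 0 < s := by linarith
  have hs₁ : s < 1 := by linarith [div_pos hd₀ he]
  refine ⟨fun i => ((1 - s) * w i + s / 2) / d, fun i => ?_, ?_, (1 - s) * e / d, ?_,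
    fun α hα => ?_⟩
  · have := mul_nonneg (sub_nonneg.2 hs₁.le) (hw₀ i)
    positivity
  · rw [← Finset.sum_div, Finset.sum_add_distrib, ← Finset.mul_sum, hw₁, Fin.sum_const,
      nsmul_eq_mul]
    push_cast
    ring
  · have : (1 - s) * e = (e + d) / 2 := by
      rw [hs]
      field_simp
      ring
    rw [gt_iff_lt, one_lt_div hd₀]
    linarith
  · rw [div_le_iff₀ hd₀, Finset.sum_mul]
    calc (1 - s) * e ≤ (1 - s) * ∑ i, w i * α i :=
          mul_le_mul_of_nonneg_left (hwe α hα) (sub_nonneg.2 hs₁.le)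
      _ = ∑ i, (1 - s) * (w i * α i) := Finset.mul_sum _ _ _
      _ ≤ _ := Finset.sum_le_sum fun i _ => ?_
    have : 0 ≤ s / 2 * α i := by positivity
    field_simp
    linarith

/-! ### Anisotropic Taylor estimate -/

section PartialDerivatives

variable {f g : Plane → ℝ} {x : Plane}

theorem contDiffAt_partialDeriv (hf : ContDiffAt ℝ ∞ f x) (i : Fin 2) :
    ContDiffAt ℝ ∞ (partialDeriv i f) x :=
  (hf.fderiv_right (m := ∞) (by simp)).clm_apply contDiffAt_const

theorem partialDeriv_congr (h : f =ᶠ[𝓝 x] g) (i : Fin 2) :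
    partialDeriv i f =ᶠ[𝓝 x] partialDeriv i g :=
  h.fderiv.fun_comp fun L : Plane →L[ℝ] ℝ => L (EuclideanSpace.single i 1)

theorem iterate_partialDeriv_congr (h : f =ᶠ[𝓝 x] g) (i : Fin 2) (n : ℕ) :
    (partialDeriv i)^[n] f =ᶠ[𝓝 x] (partialDeriv i)^[n] g := by
  induction n with
  | zero => exact h
  | succ n ih =>
    simp only [Function.iterate_succ_apply']
    exact partialDeriv_congr ih i

theorem contDiffAt_iterate_partialDeriv (hf : ContDiffAt ℝ ∞ f x) (i : Fin 2) (n : ℕ) :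
    ContDiffAt ℝ ∞ ((partialDeriv i)^[n] f) x := by
  induction n with
  | zero => exact hf
  | succ n ih =>
    rw [Function.iterate_succ_apply']
    exact contDiffAt_partialDeriv ih i

theorem partialDeriv_partialDeriv_apply (hf : ContDiffAt ℝ 2 f x) (i j : Fin 2) :
    partialDeriv i (partialDeriv j f) x =
      fderiv ℝ (fderiv ℝ f) x (EuclideanSpace.single i 1) (EuclideanSpace.single j 1) := by
  have hd : DifferentiableAt ℝ (fderiv ℝ f) x :=
    (hf.fderiv_right (m := 1) le_rfl).differentiableAt one_ne_zero
  change fderiv ℝ (fun y => fderiv ℝ f y (EuclideanSpace.single j 1)) x _ = _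
  rw [fderiv_clm_apply hd (differentiableAt_const _)]
  simp

theorem partialDeriv_comm (hf : ContDiffAt ℝ ∞ f x) (i j : Fin 2) :
    partialDeriv i (partialDeriv j f) =ᶠ[𝓝 x] partialDeriv j (partialDeriv i f) := by
  have h₂ : ContDiffAt ℝ 2 f x := hf.of_le ENat.LEInfty.out
  filter_upwards [h₂.eventually (by simp)] with y hy
  rw [partialDeriv_partialDeriv_apply hy, partialDeriv_partialDeriv_apply hy]
  exact hy.isSymmSndFDerivAt (by simp) _ _

theorem partialDeriv_iterate_comm (hf : ContDiffAt ℝ ∞ f x) (i j : Fin 2) (n : ℕ) :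
    partialDeriv i ((partialDeriv j)^[n] f) =ᶠ[𝓝 x] (partialDeriv j)^[n] (partialDeriv i f) := by
  induction n with
  | zero => rfl
  | succ n ih =>
    simp only [Function.iterate_succ_apply']
    exact (partialDeriv_comm (contDiffAt_iterate_partialDeriv hf j n) i j).trans
      (partialDeriv_congr ih j)

theorem taylorCoeff_partialDeriv (hf : ContDiffAt ℝ ∞ f 0) (i : Fin 2) (α : Fin 2 → ℕ) :
    taylorCoeff (partialDeriv i f) α = (α i + 1) * taylorCoeff f (α + Pi.single i 1) := by
  fin_cases i
  · have h : (partialDeriv 0)^[α 0] (partialDeriv 0 ((partialDeriv 1)^[α 1] f)) 0 =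
        (partialDeriv 0)^[α 0] ((partialDeriv 1)^[α 1] (partialDeriv 0 f)) 0 :=
      (iterate_partialDeriv_congr (partialDeriv_iterate_comm hf 0 1 (α 1)) 0 (α 0)).eq_of_nhds
    simp only [taylorCoeff, Fin.zero_eta, ← h, Pi.add_apply, Pi.single_eq_same, ne_eq, one_ne_zero,
      not_false_eq_true, Pi.single_eq_of_ne, add_zero, Function.iterate_succ, Function.comp_apply,
      Nat.factorial_succ, Nat.cast_mul, Nat.cast_add, Nat.cast_one]
    field_simp
  · simp only [taylorCoeff, Fin.mk_one, Pi.add_apply, ne_eq, zero_ne_one, not_false_eq_true,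
      Pi.single_eq_of_ne, add_zero, Pi.single_eq_same, Function.iterate_succ, Function.comp_apply,
      Nat.factorial_succ, Nat.cast_mul, Nat.cast_add, Nat.cast_one]
    field_simp

theorem taylorCoeff_zero (f : Plane → ℝ) : taylorCoeff f 0 = f 0 := by
  simp [taylorCoeff]

theorem fderiv_apply_eq_sum_partialDeriv (f : Plane → ℝ) (x y : Plane) :
    fderiv ℝ f x y = ∑ i, y i * partialDeriv i f x := by
  conv_lhs => rw [← (EuclideanSpace.basisFun (Fin 2) ℝ).sum_repr y]
  simp [partialDeriv]

end PartialDerivatives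

/-- The box of half-widths `ρ ^ κ i`, on which every monomial `x ^ α` is bounded by
`ρ ^ ∑ i, κ i * α i`. -/
def anisotropicBox {ι : Type*} (κ : ι → ℝ) (ρ : ℝ) : Set (EuclideanSpace ℝ ι) :=
  {x | ∀ i, |x i| ≤ ρ ^ κ i}

theorem segment_subset_anisotropicBox {ι : Type*} {κ : ι → ℝ} {ρ : ℝ} {x : EuclideanSpace ℝ ι}
    (hx : x ∈ anisotropicBox κ ρ) : segment ℝ 0 x ⊆ anisotropicBox κ ρ := by
  rw [segment_eq_image]
  rintro _ ⟨τ, ⟨hτ₀, hτ₁⟩, rfl⟩ i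
  simp only [smul_zero, zero_add, PiLp.smul_apply, smul_eq_mul, abs_mul, abs_of_nonneg hτ₀]
  exact (mul_le_of_le_one_left (abs_nonneg _) hτ₁).trans (hx i)

theorem tendsto_anisotropicBox {ι : Type*} [Finite ι] {κ : ι → ℝ} (hκ : ∀ i, 0 < κ i) :
    Tendsto (anisotropicBox κ) (𝓝[>] 0) (𝓝 0).smallSets := by
  have := Fintype.ofFinite ι
  refine tendsto_smallSets_iff.2 fun s hs => ?_
  have hs' : WithLp.toLp 2 ⁻¹' s ∈ 𝓝 (0 : ι → ℝ) :=
    (PiLp.continuous_toLp 2 fun _ : ι => ℝ).continuousAt.preimage_mem_nhds hs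
  obtain ⟨δ, hδ, hball⟩ := Metric.mem_nhds_iff.1 hs'
  have hlt : ∀ᶠ ρ : ℝ in 𝓝[>] 0, ∀ i, ρ ^ κ i < δ := by
    refine eventually_all.2 fun i => Tendsto.eventually_lt_const hδ ?_
    have h := (Real.continuousAt_rpow_const 0 (κ i) (Or.inr (hκ i).le)).tendsto
    rw [Real.zero_rpow (hκ i).ne'] at h
    exact h.mono_left nhdsWithin_le_nhds
  filter_upwards [hlt] with ρ hρ x hx
  have hxδ : ‖WithLp.ofLp x‖ < δ := (pi_norm_lt_iff hδ).2 fun i => (hx i).trans_lt (hρ i)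
  exact hball (mem_ball_zero_iff.2 hxδ)

theorem eventually_abs_le_on_anisotropicBox_of_nonpos {ι : Type*} [Finite ι] {κ : ι → ℝ}
    (hκ : ∀ i, 0 < κ i) {f : EuclideanSpace ℝ ι → ℝ} (hf : ContinuousAt f 0) {m : ℝ}
    (hm : m ≤ 0) :
    ∃ C, ∀ᶠ ρ in 𝓝[>] 0, ∀ x ∈ anisotropicBox κ ρ, |f x| ≤ C * ρ ^ m := by
  refine ⟨|f 0| + 1, ?_⟩
  have hbdd : ∀ᶠ x in 𝓝 0, |f x| < |f 0| + 1 :=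
    hf.abs.eventually_lt continuousAt_const (lt_add_one _)
  filter_upwards [(tendsto_anisotropicBox hκ).eventually hbdd.smallSets,
    Ioc_mem_nhdsGT one_pos] with ρ hρ hρ₁ x hx
  exact (hρ x hx).le.trans (le_mul_of_one_le_right (by positivity)
    (Real.one_le_rpow_of_pos_of_le_one_of_nonpos hρ₁.1 hρ₁.2 hm))

theorem eventually_abs_le_on_anisotropicBox_of_partialDeriv {κ : Fin 2 → ℝ} (hκ : ∀ i, 0 < κ i)
    {f : Plane → ℝ} (hf : ∀ᶠ x in 𝓝 0, DifferentiableAt ℝ f x) (hf₀ : f 0 = 0) {m : ℝ}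
    {C : Fin 2 → ℝ} (hC : ∀ i, ∀ᶠ ρ in 𝓝[>] 0, ∀ x ∈ anisotropicBox κ ρ,
      |partialDeriv i f x| ≤ C i * ρ ^ (m - κ i)) :
    ∀ᶠ ρ in 𝓝[>] 0, ∀ x ∈ anisotropicBox κ ρ, |f x| ≤ (∑ i, C i) * ρ ^ m := by
  filter_upwards [(tendsto_anisotropicBox hκ).eventually hf.smallSets, eventually_all.2 hC,
    self_mem_nhdsWithin] with ρ hdiff hC hρ x hx
  have hseg := segment_subset_anisotropicBox hx
  obtain ⟨z, hz, hfz⟩ := domain_mvt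
    (fun y hy => (hdiff y (hseg hy)).hasFDerivAt.hasFDerivWithinAt)
    (convex_segment 0 x) (left_mem_segment ℝ 0 x) (right_mem_segment ℝ 0 x)
  rw [hf₀, sub_zero, sub_zero, fderiv_apply_eq_sum_partialDeriv] at hfz
  rw [hfz, Finset.sum_mul]
  refine (Finset.abs_sum_le_sum_abs _ _).trans (Finset.sum_le_sum fun i _ => ?_)
  calc |x i * partialDeriv i f z| ≤ ρ ^ κ i * (C i * ρ ^ (m - κ i)) := by
        rw [abs_mul]
        exact mul_le_mul (hx i) (hC i z (hseg hz)) (abs_nonneg _) (Real.rpow_nonneg hρ.le _)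
    _ = C i * ρ ^ m := by
        rw [mul_left_comm, ← Real.rpow_add hρ, add_sub_cancel]

theorem exists_eventually_abs_le_on_anisotropicBox {κ : Fin 2 → ℝ} (hκ : ∀ i, 0 < κ i)
    {f : Plane → ℝ} (hf : ContDiffAt ℝ ∞ f 0) {m : ℝ}
    (hm : ∀ α : Fin 2 → ℕ, ∑ i, κ i * α i < m → taylorCoeff f α = 0) :
    ∃ C, ∀ᶠ ρ in 𝓝[>] 0, ∀ x ∈ anisotropicBox κ ρ, |f x| ≤ C * ρ ^ m := by
  obtain ⟨μ, hμ, hμκ⟩ : ∃ μ > 0, ∀ i, μ ≤ κ i :=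
    ⟨min (κ 0) (κ 1), lt_min (hκ 0) (hκ 1),
      Fin.forall_fin_two.2 ⟨min_le_left _ _, min_le_right _ _⟩⟩
  obtain ⟨n, hn⟩ := exists_nat_ge (m / μ)
  rw [div_le_iff₀ hμ] at hn
  induction n generalizing m f with
  | zero =>
    exact eventually_abs_le_on_anisotropicBox_of_nonpos hκ hf.continuousAt (by simpa using hn)
  | succ n ih =>
    rcases le_or_gt m 0 with hm₀ | hm₀
    · exact eventually_abs_le_on_anisotropicBox_of_nonpos hκ hf.continuousAt hm₀
    have hpartial (i : Fin 2) : ∃ C, ∀ᶠ ρ in 𝓝[>] 0, ∀ x ∈ anisotropicBox κ ρ,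
        |partialDeriv i f x| ≤ C * ρ ^ (m - κ i) := by
      refine ih (contDiffAt_partialDeriv hf i) (fun α hα => ?_) ?_
      · have hsingle : ∑ j, κ j * ((Pi.single i 1 : Fin 2 → ℕ) j : ℝ) = κ i := by
          simp [Pi.single_apply]
        rw [taylorCoeff_partialDeriv hf, hm, mul_zero]
        simp only [Pi.add_apply, Nat.cast_add, mul_add, Finset.sum_add_distrib, hsingle]
        linarith
      · push_cast at hn
        linarith [hμκ i]
    choose C hC using hpartial
    have hdiff : ∀ᶠ x in 𝓝 0, DifferentiableAt ℝ f x :=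
      ((hf.of_le (m := 1) ENat.LEInfty.out).eventually (by simp)).mono
        fun x hx => hx.differentiableAt one_ne_zero
    have hf₀ : f 0 = 0 := taylorCoeff_zero f ▸ hm 0 (by simpa using hm₀)
    exact ⟨_, eventually_abs_le_on_anisotropicBox_of_partialDeriv hκ hdiff hf₀ hC⟩

theorem eventually_abs_le_mul_on_anisotropicBox {κ : Fin 2 → ℝ} (hκ : ∀ i, 0 < κ i)
    {f : Plane → ℝ} (hf : ContDiffAt ℝ ∞ f 0) (hf₀ : f 0 = 0) {m : ℝ} (hm : 1 < m)
    (hκm : ∀ α ∈ taylorSupport f, m ≤ ∑ i, κ i * α i) {ε : ℝ} (hε : 0 < ε) :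
    ∀ᶠ ρ in 𝓝[>] 0, ∀ x ∈ anisotropicBox κ ρ, |f x| ≤ ε * ρ := by
  obtain ⟨C, hC⟩ := exists_eventually_abs_le_on_anisotropicBox hκ hf fun α hα => by
    by_contra hne
    rcases eq_or_ne α 0 with rfl | hα₀
    · exact hne (hf₀ ▸ taylorCoeff_zero f)
    · exact (hκm α ⟨hα₀, hne⟩).not_gt hα
  have hsmall : ∀ᶠ ρ : ℝ in 𝓝[>] 0, C * ρ ^ (m - 1) ≤ ε := by
    have hm' : 0 < m - 1 := sub_pos.2 hm
    have h := (Real.continuousAt_rpow_const 0 (m - 1) (Or.inr hm'.le)).tendsto.const_mul C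
    rw [Real.zero_rpow hm'.ne', mul_zero] at h
    exact (h.mono_left nhdsWithin_le_nhds).eventually_le_const hε
  filter_upwards [hC, hsmall, self_mem_nhdsWithin] with ρ hC hρε hρ x hx
  calc |f x| ≤ C * ρ ^ m := hC x hx
    _ = C * ρ ^ (m - 1) * ρ := by rw [mul_assoc, ← Real.rpow_add_one hρ.ne', sub_add_cancel]
    _ ≤ ε * ρ := mul_le_mul_of_nonneg_right hρε hρ.le

/-! ### Homogeneous symbols -/

section Homogeneous

variable {E F : Type*} [NormedAddCommGroup E] [NormedSpace ℝ E] [NormedAddCommGroup F]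
  [NormedSpace ℝ F]

/-- Positive homogeneity of degree `m` off the origin, as required of the terms of a classical
symbol; nothing is said about the value at the origin. -/
def IsHomogeneousOfDegree (m : ℝ) (b : E → F) : Prop :=
  ∀ ξ, ξ ≠ 0 → ∀ t : ℝ, 0 < t → b (t • ξ) = t ^ m • b ξ

namespace IsHomogeneousOfDegree

variable {m : ℝ} {b : E → F}

theorem eq_rpow_norm_smul (hb : IsHomogeneousOfDegree m b) {ξ : E} (hξ : ξ ≠ 0) :
    b ξ = ‖ξ‖ ^ m • b (‖ξ‖⁻¹ • ξ) := by
  have hpos : 0 < ‖ξ‖ := norm_pos_iff.2 hξ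
  rw [← hb _ (smul_ne_zero (inv_ne_zero hpos.ne') hξ) _ hpos, smul_inv_smul₀ hpos.ne']

theorem exists_norm_le [ProperSpace E] (hb : IsHomogeneousOfDegree m b)
    (hcont : ContinuousOn b {0}ᶜ) : ∃ C, ∀ ξ, ξ ≠ 0 → ‖b ξ‖ ≤ C * ‖ξ‖ ^ m := by
  have hsphere : Metric.sphere (0 : E) 1 ⊆ {0}ᶜ := fun ξ hξ =>
    ne_zero_of_mem_unit_sphere ⟨ξ, hξ⟩
  obtain ⟨C, hC⟩ := (isCompact_sphere (0 : E) 1).exists_bound_of_continuousOn (hcont.mono hsphere)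
  refine ⟨C, fun ξ hξ => ?_⟩
  have hunit : ‖ξ‖⁻¹ • ξ ∈ Metric.sphere (0 : E) 1 := by
    rw [mem_sphere_zero_iff_norm, norm_smul, norm_inv, norm_norm,
      inv_mul_cancel₀ (norm_ne_zero_iff.2 hξ)]
  rw [hb.eq_rpow_norm_smul hξ, norm_smul, Real.norm_of_nonneg (by positivity), mul_comm C]
  exact mul_le_mul_of_nonneg_left (hC _ hunit) (by positivity)

theorem fderiv (hb : IsHomogeneousOfDegree m b) : IsHomogeneousOfDegree (m - 1) (fderiv ℝ b) := by
  intro ξ hξ t ht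
  have heq : (fun η => b (t • η)) =ᶠ[𝓝 ξ] t ^ m • b :=
    (isOpen_ne.eventually_mem hξ).mono fun η hη => hb η hη t ht
  have h := heq.fderiv_eq (𝕜 := ℝ)
  rw [fderiv_comp_smul, fderiv_const_smul_field, Pi.smul_apply] at h
  rw [Real.rpow_sub_one ht.ne', div_eq_inv_mul, mul_smul, ← h, inv_smul_smul₀ ht.ne']

theorem iteratedFDeriv (hb : IsHomogeneousOfDegree m b) (n : ℕ) :
    IsHomogeneousOfDegree (m - n) (iteratedFDeriv ℝ n b) := by
  induction n with
  | zero =>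
    intro ξ hξ t ht
    ext
    simp [hb ξ hξ t ht]
  | succ n ih =>
    intro ξ hξ t ht
    rw [iteratedFDeriv_succ_eq_comp_left, Function.comp_apply, Function.comp_apply,
      ih.fderiv ξ hξ t ht, map_smul, Nat.cast_succ, sub_sub]

theorem exists_norm_iteratedFDeriv_le [ProperSpace E] (hb : IsHomogeneousOfDegree m b)
    (hsmooth : ContDiffOn ℝ ∞ b {0}ᶜ) (n : ℕ) :
    ∃ C, ∀ ξ, ξ ≠ 0 → ‖_root_.iteratedFDeriv ℝ n b ξ‖ ≤ C * ‖ξ‖ ^ (m - n) :=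
  (hb.iteratedFDeriv n).exists_norm_le <|
    (hsmooth.continuousOn_iteratedFDerivWithin (mod_cast le_top)
      isOpen_compl_singleton.uniqueDiffOn).congr
      fun _ hξ => (iteratedFDerivWithin_of_isOpen n isOpen_compl_singleton hξ).symm

end IsHomogeneousOfDegree

end Homogeneous

section OriginCutoff

variable {E : Type*} [NormedAddCommGroup E]

/-- A smooth function vanishing near the origin and equal to one near `{ξ | 1 ≤ ‖ξ‖}`; multiplying
a homogeneous function by it gives a symbol. -/
noncomputable def originCutoff (ξ : E) : ℝ :=
  Real.smoothTransition (4 * ‖ξ‖ ^ 2 - 1)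

theorem contDiff_originCutoff [InnerProductSpace ℝ E] : ContDiff ℝ ∞ (originCutoff : E → ℝ) :=
  Real.smoothTransition.contDiff.comp
    ((contDiff_const.mul (contDiff_norm_sq ℝ)).sub contDiff_const)

theorem originCutoff_nonneg (ξ : E) : 0 ≤ originCutoff ξ :=
  Real.smoothTransition.nonneg _

theorem originCutoff_eventuallyEq_zero : (originCutoff : E → ℝ) =ᶠ[𝓝 0] 0 := by
  filter_upwards [Metric.ball_mem_nhds (0 : E) one_half_pos] with ξ hξ
  have hξ : ‖ξ‖ < 1 / 2 := mem_ball_zero_iff.1 hξ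
  exact Real.smoothTransition.zero_of_nonpos (by nlinarith [norm_nonneg ξ])

theorem originCutoff_eventuallyEq_one {ξ : E} (hξ : 1 ≤ ‖ξ‖) :
    (originCutoff : E → ℝ) =ᶠ[𝓝 ξ] 1 := by
  filter_upwards [continuous_norm.continuousAt.eventually_const_lt
    (show (3 / 4 : ℝ) < ‖ξ‖ by linarith)] with η hη
  exact Real.smoothTransition.one_of_one_le (by nlinarith)

theorem zero_notMem_tsupport_originCutoff : (0 : E) ∉ tsupport (originCutoff : E → ℝ) :=
  notMem_tsupport_iff_eventuallyEq.2 originCutoff_eventuallyEq_zero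

theorem contDiff_originCutoff_smul [InnerProductSpace ℝ E] {F : Type*} [NormedAddCommGroup F]
    [NormedSpace ℝ F] {b : E → F} (hb : ContDiffOn ℝ ∞ b {0}ᶜ) :
    ContDiff ℝ ∞ fun ξ => originCutoff ξ • b ξ := by
  refine contDiff_iff_contDiffAt.2 fun ξ => ?_
  rcases eq_or_ne ξ 0 with rfl | hξ
  · refine (contDiffAt_const (c := (0 : F))).congr_of_eventuallyEq ?_
    filter_upwards [originCutoff_eventuallyEq_zero] with η hη
    simp [hη]
  · exact contDiff_originCutoff.contDiffAt.smul
      (hb.contDiffAt (isOpen_compl_singleton.mem_nhds hξ))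

end OriginCutoff

theorem isClassicalSymbol_originCutoff_smul {m : ℝ} {b : Space → ℂ} (hb : IsHomogeneousOfDegree m b)
    (hsmooth : ContDiffOn ℝ ∞ b {0}ᶜ) : IsClassicalSymbol m fun ξ => originCutoff ξ • b ξ := by
  have heq {ξ : Space} (hξ : 1 ≤ ‖ξ‖) : (fun ξ => originCutoff ξ • b ξ) =ᶠ[𝓝 ξ] b :=
    (originCutoff_eventuallyEq_one hξ).mono fun η hη => by simp [hη]
  refine ⟨contDiff_originCutoff_smul hsmooth, Pi.single 0 b, fun j => ?_, fun j ξ hξ t ht => ?_,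
    fun N n => ?_⟩
  · rcases j with _ | _
    · simpa using hsmooth
    · exact contDiffOn_const (c := (0 : ℂ))
  · rcases j with _ | _
    · simpa using hb ξ hξ t ht
    · simp
  · rcases N with _ | N
    · obtain ⟨C, hC⟩ := hb.exists_norm_iteratedFDeriv_le hsmooth n
      refine ⟨C, fun ξ hξ => ?_⟩
      simp only [Finset.range_zero, Finset.sum_empty, sub_zero, Nat.cast_zero]
      rw [((heq hξ).iteratedFDeriv ℝ n).self_of_nhds]
      exact hC ξ (norm_pos_iff.1 (one_pos.trans_le hξ))
    · refine ⟨0, fun ξ hξ => ?_⟩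
      have hzero : (fun η => originCutoff η • b η -
          ∑ j ∈ Finset.range (N + 1), (Pi.single 0 b : ℕ → Space → ℂ) j η) =ᶠ[𝓝 ξ] 0 := by
        filter_upwards [heq hξ] with η hη
        simp [hη, Finset.sum_range_succ']
      rw [(hzero.iteratedFDeriv ℝ n).self_of_nhds, zero_mul, iteratedFDeriv_zero]
      simp

theorem exists_isHomogeneousOfDegree_tsupport_subset {Γ : Set Space} {v : Space}
    (hΓ : IsConicNhd Γ v) (hv : v ≠ 0) (m : ℝ) :
    ∃ b : Space → ℝ, IsHomogeneousOfDegree m b ∧ ContDiffOn ℝ ∞ b {0}ᶜ ∧ 0 ≤ b ∧ 0 < b v ∧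
      tsupport b ⊆ insert 0 Γ := by
  have hmem : ‖v‖⁻¹ • v ∈ Γ := hΓ.2.2 v hΓ.2.1 _ (inv_pos.2 (norm_pos_iff.2 hv))
  obtain ⟨χ, hχΓ, -, hχ, hχ01, hχv⟩ := exists_contDiff_tsupport_subset (n := ⊤)
    (hΓ.1.mem_nhds hmem)
  have hnorm {ξ : Space} (hξ : ξ ≠ 0) : ContDiffAt ℝ ∞ (fun ξ : Space => ‖ξ‖⁻¹ • ξ) ξ :=
    ((contDiffAt_norm ℝ hξ).inv (norm_ne_zero_iff.2 hξ)).smul contDiffAt_id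
  refine ⟨fun ξ => ‖ξ‖ ^ m * χ (‖ξ‖⁻¹ • ξ), fun ξ _ t ht => ?_, fun _ hξ => ?_, fun _ => ?_, ?_,
    fun ξ hξ => ?_⟩
  · have hdir : ‖t • ξ‖⁻¹ • t • ξ = ‖ξ‖⁻¹ • ξ := by
      rw [norm_smul, Real.norm_of_nonneg ht.le, smul_smul, mul_inv, mul_right_comm,
        inv_mul_cancel₀ ht.ne', one_mul]
    have hpow : ‖t • ξ‖ ^ m = t ^ m * ‖ξ‖ ^ m := by
      rw [norm_smul, Real.norm_of_nonneg ht.le, Real.mul_rpow ht.le (norm_nonneg ξ)]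
    simp only [hdir, hpow, smul_eq_mul, mul_assoc]
  · exact (((contDiffAt_norm ℝ hξ).rpow_const_of_ne (norm_ne_zero_iff.2 hξ)).mul
      (hχ.contDiffAt.comp _ (hnorm hξ))).contDiffWithinAt
  · exact mul_nonneg (by positivity) (hχ01 (Set.mem_range_self _)).1
  · simp only [hχv, mul_one]
    positivity
  · rcases eq_or_ne ξ 0 with rfl | hξ₀
    · exact Set.mem_insert _ _
    by_contra hξΓ
    have hdir : ‖ξ‖⁻¹ • ξ ∉ tsupport χ := fun h => hξΓ <| Or.inr <| by
      simpa [smul_inv_smul₀ (norm_ne_zero_iff.2 hξ₀)] using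
        hΓ.2.2 _ (hχΓ h) ‖ξ‖ (norm_pos_iff.2 hξ₀)
    refine notMem_tsupport_iff_eventuallyEq.2 ?_ hξ
    filter_upwards [(hnorm hξ₀).continuousAt.eventually (notMem_tsupport_iff_eventuallyEq.1 hdir)]
      with η hη
    simp [hη]

theorem exists_elliptic_symbol {Γ : Set Space} {v : Space} (hΓ : IsConicNhd Γ v) (hv : v ≠ 0)
    (m : ℝ) :
    ∃ a : Space → ℝ, (fun ξ => (a ξ : ℂ)) ∈ classicalSymbolsIn m Γ ∧ 0 ≤ a ∧
      ∃ c > 0, ∀ᶠ q : ℝ × Space in atTop ×ˢ 𝓝 v, c * q.1 ^ m ≤ a (q.1 • q.2) := by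
  obtain ⟨b, hb, hsmooth, hb₀, hbv, hsupp⟩ := exists_isHomogeneousOfDegree_tsupport_subset hΓ hv m
  have hbC : IsHomogeneousOfDegree m fun ξ => (b ξ : ℂ) := fun ξ hξ t ht => by
    simp [hb ξ hξ t ht]
  refine ⟨fun ξ => originCutoff ξ * b ξ, ⟨?_, fun ξ hξ => ?_⟩,
    fun ξ => mul_nonneg (originCutoff_nonneg ξ) (hb₀ ξ), b v / 2, half_pos hbv, ?_⟩
  · simpa using isClassicalSymbol_originCutoff_smul hbC
      (Complex.ofRealCLM.contDiff.comp_contDiffOn hsmooth)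
  · replace hξ : ξ ∈ tsupport fun ξ => originCutoff ξ * b ξ :=
      tsupport_comp_subset Complex.ofReal_zero _ hξ
    refine (hsupp (tsupport_mul_subset_right hξ)).resolve_left ?_
    rintro rfl
    exact zero_notMem_tsupport_originCutoff (tsupport_mul_subset_left hξ)
  · have hlarge : ∀ᶠ q : ℝ × Space in atTop ×ˢ 𝓝 v, 1 ≤ ‖q.1 • q.2‖ := by
      have h := tendsto_fst.atTop_mul_pos (norm_pos_iff.2 hv)
        ((continuous_norm.tendsto v).comp (tendsto_snd (f := (atTop : Filter ℝ))))
      filter_upwards [h.eventually_ge_atTop 1, tendsto_fst.eventually (eventually_ge_atTop 0)]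
        with q hq hq₀
      rwa [norm_smul, Real.norm_of_nonneg hq₀]
    have hbv' : ∀ᶠ η in 𝓝 v, b v / 2 < b η :=
      (hsmooth.continuousOn.continuousAt (isOpen_compl_singleton.mem_nhds hv)).eventually_const_lt
        (half_lt_self hbv)
    filter_upwards [hlarge, tendsto_fst.eventually (eventually_gt_atTop 0),
      tendsto_snd.eventually hbv', tendsto_snd.eventually (isOpen_ne.eventually_mem hv)]
      with ⟨t, η⟩ hη ht hbη hη₀
    rw [(originCutoff_eventuallyEq_one hη).self_of_nhds, Pi.one_apply, one_mul, hb η hη₀ t ht,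
      smul_eq_mul, mul_comm]
    exact mul_le_mul_of_nonneg_left hbη.le (Real.rpow_nonneg ht.le _)

/-! ### Affine changes of variables -/

section Affine

variable {E F : Type*} [NormedAddCommGroup E] [NormedSpace ℝ E] [FiniteDimensional ℝ E]
  [MeasurableSpace E] [BorelSpace E] (μ : Measure E) [μ.IsAddHaarMeasure] [NormedAddCommGroup F]

theorem integral_eq_abs_det_smul_integral_affine [NormedSpace ℝ F] (B : E ≃L[ℝ] E) (c : E)
    (f : E → F) :
    ∫ ξ, f ξ ∂μ = |LinearMap.det (B : E →ₗ[ℝ] E)| • ∫ y, f (c + B y) ∂μ := by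
  have hdet := B.toLinearEquiv.isUnit_det'.ne_zero
  have hmap : ∫ ξ, f (c + ξ) ∂(μ.map (B : E →ₗ[ℝ] E)) = ∫ y, f (c + B y) ∂μ :=
    B.toHomeomorph.measurableEmbedding.integral_map fun ξ => f (c + ξ)
  rw [Measure.map_linearMap_addHaar_eq_smul_addHaar μ hdet, integral_smul_measure,
    integral_add_left_eq_self f c, ENNReal.toReal_ofReal (abs_nonneg _), abs_inv] at hmap
  rw [← hmap, smul_inv_smul₀ (abs_ne_zero.2 hdet)]

theorem eLpNorm_comp_linearMap_add {B : E →ₗ[ℝ] E} (hB : LinearMap.det B ≠ 0) (v : E) (G : E → F)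
    (q : ℝ≥0∞) :
    eLpNorm (fun x => G (B (x + v))) q μ
      = ENNReal.ofReal (|LinearMap.det B| ^ (-(1 / q.toReal))) * eLpNorm G q μ := by
  have hemb : MeasurableEmbedding B :=
    (LinearMap.equivOfDetNeZero B hB).toContinuousLinearEquiv.toHomeomorph.measurableEmbedding
  calc eLpNorm (fun x => G (B (x + v))) q μ
      = eLpNorm ((G ∘ B) ∘ fun x => x + v) q μ := rfl
    _ = eLpNorm (G ∘ B) q μ := by
        rw [← (measurableEmbedding_addRight v).eLpNorm_map_measure, map_add_right_eq_self]
    _ = ENNReal.ofReal |(LinearMap.det B)⁻¹| ^ (1 / q).toReal * eLpNorm G q μ := by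
        rw [← hemb.eLpNorm_map_measure, Measure.map_linearMap_addHaar_eq_smul_addHaar μ hB,
          eLpNorm_smul_measure_of_ne_zero (by simpa using hB), smul_eq_mul]
    _ = _ := by
        rw [ENNReal.ofReal_rpow_of_pos (by simpa using hB), abs_inv,
          Real.inv_rpow (abs_nonneg _), ← Real.rpow_neg (abs_nonneg _), one_div,
          ENNReal.toReal_inv, one_div]

end Affine

theorem det_adjoint_eq {E : Type*} [NormedAddCommGroup E] [InnerProductSpace ℝ E]
    [FiniteDimensional ℝ E] (B : E →ₗ[ℝ] E) :
    LinearMap.det (LinearMap.adjoint B) = LinearMap.det B := by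
  let b := stdOrthonormalBasis ℝ E
  rw [← LinearMap.det_toMatrix b.toBasis, ← LinearMap.det_toMatrix b.toBasis B,
    LinearMap.toMatrix_adjoint, Matrix.det_conjTranspose, star_trivial]

/-! ### Fourier inversion on Schwartz functions -/

/-- The normalising factor `(2π)^(-3/2)` of the Fourier transform. -/
noncomputable def fourierFactor : ℝ := (Real.sqrt ((2 * Real.pi) ^ 3))⁻¹

theorem fourierFactor_pos : 0 < fourierFactor := by
  unfold fourierFactor
  positivity

theorem fourierFactor_mul_self : fourierFactor * fourierFactor = ((2 * Real.pi) ^ 3)⁻¹ := by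
  rw [fourierFactor, ← mul_inv, Real.mul_self_sqrt (by positivity)]

section Inversion

open scoped FourierTransform

theorem fourierOpInv_eq_fourier (w : Space → ℂ) (x : Space) :
    fourierOpInv w x = fourierFactor * 𝓕 w ((2 * Real.pi)⁻¹ • x) := by
  rw [fourierOpInv, Real.fourier_eq', fourierFactor]
  congr! 4 with ξ
  rw [inner_smul_right]
  push_cast
  field_simp

theorem fourierOp_eq_fourierInv (u : Space → ℂ) (ξ : Space) :
    fourierOp u ξ = fourierFactor * 𝓕⁻ u ((2 * Real.pi)⁻¹ • ξ) := by
  rw [fourierOp, Real.fourierInv_eq', fourierFactor]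
  congr! 4 with x
  rw [inner_smul_right, real_inner_comm]
  push_cast
  field_simp

theorem fourierInv_comp_smul {V F : Type*} [NormedAddCommGroup V] [InnerProductSpace ℝ V]
    [FiniteDimensional ℝ V] [MeasurableSpace V] [BorelSpace V] [NormedAddCommGroup F]
    [NormedSpace ℂ F] (f : V → F) (R : ℝ) (x : V) :
    𝓕⁻ (fun y => f (R • y)) (R • x) = |(R ^ Module.finrank ℝ V)⁻¹| • 𝓕⁻ f x := by
  simp only [Real.fourierInv_eq']
  rw [← Measure.integral_comp_smul]
  simp only [inner_smul_right, real_inner_smul_left]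

theorem exists_schwartz_fourierOpInv (w : SchwartzMap Space ℂ) :
    ∃ u : SchwartzMap Space ℂ, ⇑u = fourierOpInv w ∧ fourierOp u = w := by
  have h2π : (2 * Real.pi)⁻¹ ≠ 0 := by positivity
  let dilation : Space ≃L[ℝ] Space := ContinuousLinearEquiv.smulLeft (Units.mk0 _ h2π)
  let s := SchwartzMap.compCLMOfContinuousLinearEquiv ℂ dilation (𝓕 w)
  have hs : ⇑s = fun x => 𝓕 (w : Space → ℂ) ((2 * Real.pi)⁻¹ • x) := rfl
  refine ⟨(fourierFactor : ℂ) • s, funext fun x => (fourierOpInv_eq_fourier w x).symm,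
    funext fun ξ => ?_⟩
  have hinv : 𝓕⁻ (𝓕 (w : Space → ℂ)) ξ = w ξ := by
    rw [← SchwartzMap.fourier_coe, ← SchwartzMap.fourierInv_coe,
      FourierTransform.fourierInv_fourier_eq]
  have hconst : (fourierFactor : ℂ) * (fourierFactor * (2 * Real.pi) ^ 3) = 1 := by
    rw [← mul_assoc]
    exact_mod_cast by rw [fourierFactor_mul_self, inv_mul_cancel₀ (by positivity)]
  calc fourierOp ⇑((fourierFactor : ℂ) • s) ξ
      = fourierFactor * (fourierFactor * 𝓕⁻ (s : Space → ℂ) ((2 * Real.pi)⁻¹ • ξ)) := by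
        rw [fourierOp_eq_fourierInv, ← SchwartzMap.fourierInv_coe,
          FourierTransform.fourierInv_smul, smul_apply, smul_eq_mul, SchwartzMap.fourierInv_coe]
    _ = fourierFactor * (fourierFactor * (2 * Real.pi) ^ 3) * w ξ := by
        rw [hs, fourierInv_comp_smul, hinv, finrank_euclideanSpace_fin,
          abs_of_nonneg (by positivity), inv_pow, inv_inv, Complex.real_smul]
        push_cast
        ring
    _ = w ξ := by rw [hconst, one_mul]

end Inversion

theorem ConvOpBounded.exists_eLpNorm_fourierOpInv_le {φ : Space → ℝ} {a : Space → ℂ} {p : ℝ≥0∞}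
    (h : ConvOpBounded φ a p) :
    ∃ C : ℝ≥0, ∀ w : SchwartzMap Space ℂ,
      eLpNorm (fourierOpInv fun ξ => Complex.exp (Complex.I * φ ξ) * a ξ * w ξ) p.conjExponent
        ≤ C * eLpNorm (fourierOpInv w) p := by
  obtain ⟨C, hC⟩ := h
  refine ⟨C, fun w => ?_⟩
  obtain ⟨u, hu, hFu⟩ := exists_schwartz_fourierOpInv w
  simpa only [convOp, hFu, ← hu] using hC u

/-! ### Affine wave packets -/

/-- The profile `g` transported to the image of the unit ball under `y ↦ c + B y`, times the
character which translates its inverse Fourier transform by `-v`. -/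
noncomputable def affinePacket (v : Space) (B : Space ≃L[ℝ] Space) (c : Space) (g : Space → ℂ)
    (ξ : Space) : ℂ :=
  Complex.exp (-(Complex.I * (inner ℝ ξ v : ℝ))) * g (B.symm (ξ - c))

section Packet

variable (v : Space) (B : Space ≃L[ℝ] Space) (c : Space)

theorem mul_affinePacket (m g : Space → ℂ) :
    (fun ξ => m ξ * affinePacket v B c g ξ) = affinePacket 0 B c fun y =>
      m (c + B y) * Complex.exp (-(Complex.I * (inner ℝ (c + B y) v : ℝ))) * g y := by
  ext ξ
  simp [affinePacket, mul_assoc]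

theorem contDiff_affinePacket {g : Space → ℂ} (hg : ContDiff ℝ ∞ g) :
    ContDiff ℝ ∞ (affinePacket v B c g) := by
  have hinner : ContDiff ℝ ∞ fun ξ : Space => ((inner ℝ ξ v : ℝ) : ℂ) :=
    Complex.ofRealCLM.contDiff.comp (contDiff_id.inner ℝ contDiff_const)
  exact (contDiff_const.mul hinner).neg.cexp.mul
    (hg.comp (B.symm.contDiff.comp (contDiff_id.sub contDiff_const)))

theorem hasCompactSupport_affinePacket {g : Space → ℂ} (hg : HasCompactSupport g) :
    HasCompactSupport (affinePacket v B c g) :=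
  (hg.comp_homeomorph ((Homeomorph.subRight c).trans B.symm.toHomeomorph)).mul_left

theorem norm_fourierOpInv_affinePacket (g : Space → ℂ) (x : Space) :
    ‖fourierOpInv (affinePacket v B c g) x‖ = |LinearMap.det (B : Space →ₗ[ℝ] Space)| *
      ‖fourierOpInv g (LinearMap.adjoint (B : Space →ₗ[ℝ] Space) (x + v))‖ := by
  have hintegrand (y : Space) : Complex.exp (-(Complex.I * (inner ℝ (c + B y) x : ℝ))) *
      affinePacket v B c g (c + B y) = Complex.exp (-(Complex.I * (inner ℝ c (x + v) : ℝ))) *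
        (Complex.exp (-(Complex.I *
          (inner ℝ y (LinearMap.adjoint (B : Space →ₗ[ℝ] Space) (x + v)) : ℝ))) * g y) := by
    rw [affinePacket, add_sub_cancel_left, B.symm_apply_apply, ← mul_assoc, ← mul_assoc,
      ← Complex.exp_add, ← Complex.exp_add, LinearMap.adjoint_inner_right,
      LinearEquiv.coe_coe, ContinuousLinearEquiv.coe_toLinearEquiv, inner_add_left,
      inner_add_left, inner_add_right, inner_add_right]
    push_cast
    ring_nf
  have hmodulus : ‖Complex.exp (-(Complex.I * (inner ℝ c (x + v) : ℝ)))‖ = 1 := by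
    simp [Complex.norm_exp]
  rw [fourierOpInv, integral_eq_abs_det_smul_integral_affine _ B c, fourierOpInv]
  simp only [hintegrand]
  rw [integral_const_mul, norm_mul, norm_smul, norm_mul, hmodulus, one_mul, norm_mul,
    Real.norm_eq_abs, abs_abs, mul_left_comm]

theorem eLpNorm_fourierOpInv_affinePacket (g : Space → ℂ) (q : ℝ≥0∞) :
    eLpNorm (fourierOpInv (affinePacket v B c g)) q =
      ENNReal.ofReal (|LinearMap.det (B : Space →ₗ[ℝ] Space)| ^ (1 - 1 / q.toReal)) *
        eLpNorm (fourierOpInv g) q := by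
  have hD₀ : LinearMap.det (B : Space →ₗ[ℝ] Space) ≠ 0 := B.toLinearEquiv.isUnit_det'.ne_zero
  have hD : 0 < |LinearMap.det (B : Space →ₗ[ℝ] Space)| := abs_pos.2 hD₀
  have hadj := det_adjoint_eq (B : Space →ₗ[ℝ] Space)
  have hcongr : eLpNorm (fourierOpInv (affinePacket v B c g)) q =
      eLpNorm (|LinearMap.det (B : Space →ₗ[ℝ] Space)| • fun x =>
        fourierOpInv g (LinearMap.adjoint (B : Space →ₗ[ℝ] Space) (x + v))) q :=
    eLpNorm_congr_norm_ae <| ae_of_all _ fun x => by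
      rw [norm_fourierOpInv_affinePacket, Pi.smul_apply, norm_smul, Real.norm_eq_abs, abs_abs]
  rw [hcongr, eLpNorm_const_smul, eLpNorm_comp_linearMap_add _ (hadj.trans_ne hD₀), hadj,
    Real.enorm_of_nonneg hD.le, ← mul_assoc, ← ENNReal.ofReal_mul hD.le, sub_eq_add_neg,
    Real.rpow_add hD, Real.rpow_one]

end Packet

/-! ### The Knapp example -/

theorem half_integral_le_norm_integral_exp {α : Type*} [MeasurableSpace α] {μ : Measure α}
    {θ g : α → ℝ} (hg : 0 ≤ g) (hθ : ∀ y, g y ≠ 0 → |θ y| ≤ 1)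
    (hint : Integrable (fun y => Complex.exp (Complex.I * θ y) * (g y : ℂ)) μ) :
    1 / 2 * ∫ y, g y ∂μ ≤ ‖∫ y, Complex.exp (Complex.I * θ y) * (g y : ℂ) ∂μ‖ := by
  have hg_int : Integrable g μ := by
    refine hint.norm.congr (ae_of_all _ fun y => ?_)
    simp [Complex.norm_exp, abs_of_nonneg (hg y)]
  have hre (y : α) : (Complex.exp (Complex.I * θ y) * (g y : ℂ)).re = Real.cos (θ y) * g y := by
    rw [Complex.re_mul_ofReal, mul_comm Complex.I, Complex.exp_ofReal_mul_I_re]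
  calc 1 / 2 * ∫ y, g y ∂μ = ∫ y, 1 / 2 * g y ∂μ := (integral_const_mul _ _).symm
    _ ≤ ∫ y, (Complex.exp (Complex.I * θ y) * (g y : ℂ)).re ∂μ := by
        refine integral_mono (hg_int.const_mul _) hint.re fun y => ?_
        simp only [hre]
        rcases eq_or_ne (g y) 0 with hy | hy
        · simp [hy]
        · refine mul_le_mul_of_nonneg_right ?_ (hg y)
          have hsq : θ y ^ 2 ≤ 1 := (sq_le_one_iff_abs_le_one _).2 (hθ y hy)
          linarith [Real.one_sub_sq_div_two_le_cos (x := θ y)]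
    _ = (∫ y, Complex.exp (Complex.I * θ y) * (g y : ℂ) ∂μ).re := integral_re hint
    _ ≤ _ := Complex.re_le_norm _

theorem le_norm_fourierOpInv_exp_mul {θ h : Space → ℝ} (hh : 0 ≤ h)
    (hsupp : ∀ y, h y ≠ 0 → ‖y‖ ≤ 1 ∧ |θ y| ≤ 1 / 2)
    (hint : Integrable fun y => Complex.exp (Complex.I * θ y) * (h y : ℂ))
    {x : Space} (hx : ‖x‖ ≤ 1 / 2) :
    fourierFactor * (1 / 2 * ∫ y, h y) ≤
      ‖fourierOpInv (fun y => Complex.exp (Complex.I * θ y) * (h y : ℂ)) x‖ := by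
  have hintegrand (y : Space) : Complex.exp (-(Complex.I * (inner ℝ y x : ℝ))) *
      (Complex.exp (Complex.I * θ y) * (h y : ℂ)) =
        Complex.exp (Complex.I * (θ y - inner ℝ y x : ℝ)) * (h y : ℂ) := by
    rw [← mul_assoc, ← Complex.exp_add]
    push_cast
    ring_nf
  have hint' : Integrable fun y =>
      Complex.exp (Complex.I * (θ y - inner ℝ y x : ℝ)) * (h y : ℂ) := by
    simp only [← hintegrand]
    refine hint.bdd_mul (c := 1) ?_ (ae_of_all _ fun y => by simp [Complex.norm_exp])
    exact Continuous.aestronglyMeasurable (by fun_prop)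
  have hphase (y : Space) (hy : h y ≠ 0) : |θ y - inner ℝ y x| ≤ 1 := by
    obtain ⟨hy₁, hθ⟩ := hsupp y hy
    have hinner : |inner ℝ y x| ≤ 1 / 2 := (abs_real_inner_le_norm _ _).trans
      ((mul_le_mul hy₁ hx (norm_nonneg _) zero_le_one).trans_eq (one_mul _))
    exact (abs_sub _ _).trans (by linarith)
  rw [fourierOpInv, norm_mul, ← fourierFactor, Complex.norm_real,
    Real.norm_of_nonneg fourierFactor_pos.le]
  simp only [hintegrand]
  exact mul_le_mul_of_nonneg_left (half_integral_le_norm_integral_exp hh hphase hint')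
    fourierFactor_pos.le

theorem le_eLpNorm_fourierOpInv_exp_mul {θ h : Space → ℝ} (hh : 0 ≤ h)
    (hsupp : ∀ y, h y ≠ 0 → ‖y‖ ≤ 1 ∧ |θ y| ≤ 1 / 2)
    (hint : Integrable fun y => Complex.exp (Complex.I * θ y) * (h y : ℂ))
    {q : ℝ≥0∞} (hq : q ≠ 0) :
    ENNReal.ofReal (fourierFactor * (1 / 2 * ∫ y, h y)) *
        volume (Metric.closedBall (0 : Space) (1 / 2)) ^ (1 / q.toReal) ≤
      eLpNorm (fourierOpInv fun y => Complex.exp (Complex.I * θ y) * (h y : ℂ)) q := by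
  have hM : 0 ≤ fourierFactor * (1 / 2 * ∫ y, h y) :=
    mul_nonneg fourierFactor_pos.le (mul_nonneg (by norm_num) (integral_nonneg hh))
  rw [← Real.enorm_of_nonneg hM, ← eLpNorm_indicator_const' measurableSet_closedBall
    (Metric.measure_closedBall_pos _ _ (by norm_num)).ne' hq]
  refine eLpNorm_mono fun x => ?_
  by_cases hx : x ∈ Metric.closedBall (0 : Space) (1 / 2)
  · rw [Set.indicator_of_mem hx, Real.norm_of_nonneg hM]
    exact le_norm_fourierOpInv_exp_mul hh hsupp hint (mem_closedBall_zero_iff.1 hx)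
  · rw [Set.indicator_of_notMem hx, norm_zero]
    exact norm_nonneg _

theorem integrable_exp_mul_of_continuousOn {α : Type*} [TopologicalSpace α] [T2Space α]
    [MeasurableSpace α] [OpensMeasurableSpace α] {μ : Measure α} [IsFiniteMeasureOnCompacts μ]
    {θ h : α → ℝ} {K : Set α} (hK : IsCompact K) (hθ : ContinuousOn θ K) (hh : ContinuousOn h K)
    (hsupp : Function.support h ⊆ K) :
    Integrable (fun y => Complex.exp (Complex.I * θ y) * (h y : ℂ)) μ := by
  refine IntegrableOn.integrable_of_forall_notMem_eq_zero (s := K)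
    (ContinuousOn.integrableOn_compact hK ?_) fun y hy => ?_
  · exact (continuousOn_const.mul (Complex.continuous_ofReal.comp_continuousOn hθ)).cexp.mul
      (Complex.continuous_ofReal.comp_continuousOn hh)
  · simp [Function.notMem_support.1 fun hy' => hy (hsupp hy')]

theorem ofReal_mul_le_eLpNorm_fourierOpInv_exp_mul {θ g χ : Space → ℝ}
    (hχ : Continuous χ) (hχ₀ : 0 ≤ χ) (hχ_supp : Function.support χ ⊆ Metric.closedBall 0 1)
    (hg : Continuous g) (hg₀ : 0 ≤ g) (hθ : ContinuousOn θ (Metric.closedBall 0 1)) {A : ℝ}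
    (hA : 0 ≤ A) (hball : ∀ y ∈ Metric.closedBall (0 : Space) 1, |θ y| ≤ 1 / 2 ∧ A ≤ g y)
    {q : ℝ≥0∞} (hq : q ≠ 0) :
    ENNReal.ofReal A * (ENNReal.ofReal (fourierFactor * (1 / 2 * ∫ y, χ y)) *
        volume (Metric.closedBall (0 : Space) (1 / 2)) ^ (1 / q.toReal)) ≤
      eLpNorm (fourierOpInv fun y => Complex.exp (Complex.I * θ y) * (g y * χ y : ℝ)) q := by
  have hcpt := isCompact_closedBall (0 : Space) 1
  have hsupp : Function.support (fun y => g y * χ y) ⊆ Metric.closedBall 0 1 :=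
    (Function.support_mul_subset_right g χ).trans hχ_supp
  have hmass : A * ∫ y, χ y ≤ ∫ y, g y * χ y := by
    have hint {f : Space → ℝ} (hf : Continuous f)
        (hf_supp : Function.support f ⊆ Metric.closedBall 0 1) : Integrable f :=
      hf.integrable_of_hasCompactSupport (.of_support_subset_isCompact hcpt hf_supp)
    rw [← integral_const_mul]
    refine integral_mono ((hint hχ hχ_supp).const_mul A) (hint (hg.mul hχ) hsupp) fun y => ?_
    rcases eq_or_ne (χ y) 0 with hy | hy
    · simp [hy]
    · exact mul_le_mul_of_nonneg_right (hball y (hχ_supp hy)).2 (hχ₀ y)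
  refine le_trans ?_ (le_eLpNorm_fourierOpInv_exp_mul (fun y => mul_nonneg (hg₀ y) (hχ₀ y))
    (fun y hy => ⟨mem_closedBall_zero_iff.1 (hsupp hy), (hball y (hsupp hy)).1⟩)
    (integrable_exp_mul_of_continuousOn hcpt hθ (hg.mul hχ).continuousOn hsupp) hq)
  rw [← mul_assoc, ← ENNReal.ofReal_mul hA]
  gcongr ENNReal.ofReal ?_ * _
  have := fourierFactor_pos
  calc A * (fourierFactor * (1 / 2 * ∫ y, χ y))
      = fourierFactor * (1 / 2 * (A * ∫ y, χ y)) := by ring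
    _ ≤ fourierFactor * (1 / 2 * ∫ y, g y * χ y) := by gcongr

theorem one_div_toReal_conjExponent {p : ℝ≥0∞} (hp : 1 ≤ p) :
    1 / p.conjExponent.toReal = 1 - 1 / p.toReal := by
  have hconj := (ENNReal.HolderConjugate.conjExponent hp).inv_add_inv_eq_one
  have hp_inv : p⁻¹ ≠ ⊤ := (ENNReal.inv_le_one.2 hp).trans_lt ENNReal.one_lt_top |>.ne
  have hq_inv : p.conjExponent⁻¹ ≠ ⊤ := ne_top_of_le_ne_top ENNReal.one_ne_top
    (hconj ▸ le_add_self)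
  rw [one_div, one_div, ← ENNReal.toReal_inv, ← ENNReal.toReal_inv, eq_sub_iff_add_eq',
    ← ENNReal.toReal_add hp_inv hq_inv, hconj, ENNReal.toReal_one]

theorem ofReal_rpow_two_mul_sub_one_mul_le {D s : ℝ} (hD : 0 < D) {M N K : ℝ≥0∞}
    (h : ENNReal.ofReal (D ^ s) * M ≤ K * (ENNReal.ofReal (D ^ (1 - s)) * N)) :
    ENNReal.ofReal (D ^ (2 * s - 1)) * M ≤ K * N :=
  calc ENNReal.ofReal (D ^ (2 * s - 1)) * M
      = ENNReal.ofReal (D ^ (s - 1)) * (ENNReal.ofReal (D ^ s) * M) := by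
        rw [← mul_assoc, ← ENNReal.ofReal_mul (by positivity), ← Real.rpow_add hD]
        ring_nf
    _ ≤ ENNReal.ofReal (D ^ (s - 1)) * (K * (ENNReal.ofReal (D ^ (1 - s)) * N)) := by gcongr
    _ = ENNReal.ofReal (D ^ (s - 1) * D ^ (1 - s)) * (K * N) := by
        rw [ENNReal.ofReal_mul (by positivity)]
        ring
    _ = K * N := by
        rw [← Real.rpow_add hD, sub_add_sub_cancel, sub_self, Real.rpow_zero, ENNReal.ofReal_one,
          one_mul]

theorem ConvOpBounded.exists_affine_bound {φ : Space → ℝ} {a : Space → ℂ} {p : ℝ≥0∞}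
    (h : ConvOpBounded φ a p) (hp : 1 ≤ p) {χ : Space → ℂ} (hχ : ContDiff ℝ ∞ χ)
    (hχ_supp : HasCompactSupport χ) :
    ∃ C : ℝ≥0, ∀ (v : Space) (B : Space ≃L[ℝ] Space) (c : Space),
      ENNReal.ofReal (|LinearMap.det (B : Space →ₗ[ℝ] Space)| ^ (2 / p.toReal - 1)) *
        eLpNorm (fourierOpInv fun y => Complex.exp (Complex.I * φ (c + B y)) * a (c + B y) *
          Complex.exp (-(Complex.I * (inner ℝ (c + B y) v : ℝ))) * χ y) p.conjExponent ≤ C := by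
  obtain ⟨C, hC⟩ := h.exists_eLpNorm_fourierOpInv_le
  obtain ⟨G, hG, -⟩ := exists_schwartz_fourierOpInv (hχ_supp.toSchwartzMap hχ)
  replace hG : ⇑G = fourierOpInv χ := hG
  have hG_top : eLpNorm (fourierOpInv χ) p ≠ ⊤ := hG ▸ (G.eLpNorm_lt_top _ _).ne
  refine ⟨C * (eLpNorm (fourierOpInv χ) p).toNNReal, fun v B c => ?_⟩
  rw [ENNReal.coe_mul, ENNReal.coe_toNNReal hG_top]
  obtain ⟨w, hw⟩ : ∃ w : SchwartzMap Space ℂ, ⇑w = affinePacket v B c χ :=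
    ⟨(hasCompactSupport_affinePacket v B c hχ_supp).toSchwartzMap
      (contDiff_affinePacket v B c hχ), rfl⟩
  have hpacket := hC w
  simp only [hw] at hpacket
  rw [mul_affinePacket, eLpNorm_fourierOpInv_affinePacket, eLpNorm_fourierOpInv_affinePacket,
    one_div_toReal_conjExponent hp, sub_sub_cancel] at hpacket
  have hD : 0 < |LinearMap.det (B : Space →ₗ[ℝ] Space)| :=
    abs_pos.2 B.toLinearEquiv.isUnit_det'.ne_zero
  rw [show 2 / p.toReal - 1 = 2 * (1 / p.toReal) - 1 by ring]
  exact ofReal_rpow_two_mul_sub_one_mul_le hD hpacket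

theorem ConvOpBounded.exists_knapp_bound {φ a : Space → ℝ} {p : ℝ≥0∞}
    (h : ConvOpBounded φ (fun ξ => (a ξ : ℂ)) p) (hp : 1 ≤ p) (ha : Continuous a) (ha₀ : 0 ≤ a) :
    ∃ C : ℝ, ∀ (v : Space) (B : Space ≃L[ℝ] Space) (c : Space), ∀ A ≥ 0,
      ContinuousOn (fun y => φ (c + B y)) (Metric.closedBall 0 1) →
      (∀ y ∈ Metric.closedBall (0 : Space) 1,
        |φ (c + B y) - inner ℝ (c + B y) v| ≤ 1 / 2 ∧ A ≤ a (c + B y)) →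
      A * |LinearMap.det (B : Space →ₗ[ℝ] Space)| ^ (2 / p.toReal - 1) ≤ C := by
  let χ : ContDiffBump (0 : Space) := ⟨1 / 2, 1, by norm_num, by norm_num⟩
  obtain ⟨C, hC⟩ := h.exists_affine_bound hp (Complex.ofRealCLM.contDiff.comp χ.contDiff)
    (χ.hasCompactSupport.comp_left Complex.ofReal_zero)
  set K := ENNReal.ofReal (fourierFactor * (1 / 2 * ∫ y, χ y)) *
    volume (Metric.closedBall (0 : Space) (1 / 2)) ^ (1 / p.conjExponent.toReal)
  have hK₀ : K ≠ 0 := mul_ne_zero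
    (ENNReal.ofReal_pos.2 (mul_pos fourierFactor_pos (mul_pos (by norm_num) χ.integral_pos))).ne'
    (ENNReal.rpow_pos (Metric.measure_closedBall_pos _ _ (by norm_num))
      measure_closedBall_lt_top.ne).ne'
  refine ⟨(C / K).toReal, fun v B c A hA hφ hball => ?_⟩
  have hlower := ofReal_mul_le_eLpNorm_fourierOpInv_exp_mul
    (θ := fun y => φ (c + B y) - inner ℝ (c + B y) v) (g := fun y => a (c + B y)) χ.continuous
    (fun _ => χ.nonneg) (subset_closure.trans χ.tsupport_eq.subset) (by fun_prop)
    (fun y => ha₀ (c + B y)) (hφ.sub (by fun_prop)) hA hball (q := p.conjExponent)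
    (by simp [ENNReal.conjExponent])
  have hintegrand (y : Space) :
      Complex.exp (Complex.I * (φ (c + B y) - inner ℝ (c + B y) v : ℝ)) *
        (a (c + B y) * χ y : ℝ) = Complex.exp (Complex.I * φ (c + B y)) * a (c + B y) *
          Complex.exp (-(Complex.I * (inner ℝ (c + B y) v : ℝ))) * χ y := by
    push_cast
    rw [mul_sub, sub_eq_add_neg, Complex.exp_add]
    ring
  simp only [hintegrand] at hlower
  rw [← ENNReal.ofReal_le_iff_le_toReal (ENNReal.div_ne_top ENNReal.coe_ne_top hK₀),
    ENNReal.le_div_iff_mul_le (.inl hK₀) (.inr ENNReal.coe_ne_top), mul_comm A,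
    ENNReal.ofReal_mul (by positivity), mul_assoc]
  exact (mul_le_mul_right hlower _).trans (hC v B c)

/-! ### Knapp examples for homogeneous phases -/

theorem exists_diagonal_continuousLinearEquiv {ι : Type*} [Fintype ι] (δ : ι → ℝ)
    (hδ : ∀ i, δ i ≠ 0) :
    ∃ D : EuclideanSpace ℝ ι ≃L[ℝ] EuclideanSpace ℝ ι, (∀ y i, D y i = δ i * y i) ∧
      LinearMap.det (D : EuclideanSpace ℝ ι →ₗ[ℝ] EuclideanSpace ℝ ι) = ∏ i, δ i := by
  classical
  have hdet : LinearMap.det (Matrix.toEuclideanLin (Matrix.diagonal δ)) = ∏ i, δ i := by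
    rw [Matrix.toEuclideanLin_eq_toLin_orthonormal, LinearMap.det_toLin, Matrix.det_diagonal]
  have hdet₀ : LinearMap.det (Matrix.toEuclideanLin (Matrix.diagonal δ)) ≠ 0 :=
    hdet ▸ Finset.prod_ne_zero_iff.2 fun i _ => hδ i
  exact ⟨(LinearMap.equivOfDetNeZero _ hdet₀).toContinuousLinearEquiv,
    fun y i => Matrix.mulVec_diagonal δ y.ofLp i, hdet⟩

theorem ConvOpBounded.exists_knapp_bound_of_homogeneous {φ a : Space → ℝ} {p : ℝ≥0∞}
    (h : ConvOpBounded φ (fun ξ => (a ξ : ℂ)) p) (hp : 1 ≤ p) (ha : Continuous a) (ha₀ : 0 ≤ a)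
    {Γ : Set Space} (hΓ : ∀ ξ ∈ Γ, ∀ t : ℝ, 0 < t → t • ξ ∈ Γ) (hφ : ContinuousOn φ Γ)
    (hφ_hom : ∀ ξ ∈ Γ, ∀ t : ℝ, 0 < t → φ (t • ξ) = t * φ ξ) :
    ∃ C : ℝ, ∀ (v w : Space) (S : Space ≃L[ℝ] Space) (κ : Fin 3 → ℝ), ∀ A ≥ 0, ∀ t > 0,
      (∀ z ∈ anisotropicBox κ t⁻¹, v + S z ∈ Γ ∧
        |φ (v + S z) - inner ℝ (v + S z) w| ≤ t⁻¹ / 2 ∧ A ≤ a (t • (v + S z))) →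
      A * (|LinearMap.det (S : Space →ₗ[ℝ] Space)| * t ^ (3 - ∑ i, κ i)) ^ (2 / p.toReal - 1)
        ≤ C := by
  obtain ⟨C, hC⟩ := h.exists_knapp_bound hp ha ha₀
  refine ⟨C, fun v w S κ A hA t ht hbox => ?_⟩
  obtain ⟨D, hD, hD_det⟩ := exists_diagonal_continuousLinearEquiv (fun i => t ^ (1 - κ i))
    fun i => (Real.rpow_pos_of_pos ht _).ne'
  have hmem {y : Space} (hy : y ∈ Metric.closedBall (0 : Space) 1) :
      t⁻¹ • D y ∈ anisotropicBox κ t⁻¹ := fun i => by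
    have hyi : |y i| ≤ 1 := (PiLp.norm_apply_le y i).trans (mem_closedBall_zero_iff.1 hy)
    rw [PiLp.smul_apply, hD, smul_eq_mul, Real.rpow_sub ht, Real.rpow_one, Real.inv_rpow ht.le,
      ← mul_assoc, inv_mul_eq_div, div_div_cancel_left' ht.ne', abs_mul,
      abs_of_pos (inv_pos.2 (Real.rpow_pos_of_pos ht _))]
    exact mul_le_of_le_one_right (by positivity) hyi
  have hscale (y : Space) : t • v + (D.trans S) y = t • (v + S (t⁻¹ • D y)) := by
    rw [map_smul, smul_add, smul_inv_smul₀ ht.ne', ContinuousLinearEquiv.trans_apply]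
  have hdet : |LinearMap.det ((D.trans S : Space ≃L[ℝ] Space) : Space →ₗ[ℝ] Space)|
      = |LinearMap.det (S : Space →ₗ[ℝ] Space)| * t ^ (3 - ∑ i, κ i) := by
    have hcomp : ((D.trans S : Space ≃L[ℝ] Space) : Space →ₗ[ℝ] Space)
        = (S : Space →ₗ[ℝ] Space) ∘ₗ (D : Space →ₗ[ℝ] Space) := rfl
    rw [hcomp, LinearMap.det_comp, hD_det, ← Real.rpow_sum_of_pos ht, abs_mul,
      abs_of_pos (Real.rpow_pos_of_pos ht _)]
    simp [Finset.sum_sub_distrib]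
  rw [← hdet]
  refine hC w (D.trans S) (t • v) A hA
    (hφ.comp (by fun_prop) fun y hy => hscale y ▸ hΓ _ (hbox _ (hmem hy)).1 t ht)
    fun y hy => ?_
  obtain ⟨hΓy, hφy, hay⟩ := hbox _ (hmem hy)
  rw [hscale, hφ_hom _ hΓy t ht, real_inner_smul_left, ← mul_sub, abs_mul, abs_of_pos ht]
  exact ⟨(mul_le_mul_of_nonneg_left hφy ht.le).trans_eq (by field_simp), hay⟩

theorem nonpos_of_eventually_rpow_le {e C : ℝ} (h : ∀ᶠ t : ℝ in atTop, t ^ e ≤ C) : e ≤ 0 := by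
  by_contra! he
  obtain ⟨t, ht, htC⟩ := (((tendsto_rpow_atTop he).eventually_gt_atTop C).and h).exists
  exact absurd htC ht.not_ge

theorem mul_le_of_forall_convOpBounded {φ : Space → ℝ} {Γ₀ Γ : Set Space} {v w : Space}
    (hv : v ≠ 0) (hΓ₀ : IsConicNhd Γ₀ v) (hφ : ContinuousOn φ Γ₀)
    (hφ_hom : ∀ ξ ∈ Γ₀, ∀ t : ℝ, 0 < t → φ (t • ξ) = t * φ ξ) (hΓ : IsConicNhd Γ v)
    {p : ℝ≥0∞} (hp : 1 ≤ p) {k : ℝ} (hbd : ∀ a ∈ classicalSymbolsIn (-k) Γ, ConvOpBounded φ a p)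
    {κ : Fin 3 → ℝ} (hκ : ∀ i, 0 < κ i) {S : Space ≃L[ℝ] Space}
    (hbox : ∀ᶠ ρ in 𝓝[>] 0, ∀ z ∈ anisotropicBox κ ρ,
      |φ (v + S z) - inner ℝ (v + S z) w| ≤ ρ / 2) :
    (3 - ∑ i, κ i) * (2 / p.toReal - 1) ≤ k := by
  obtain ⟨a, ha, ha₀, c, hc, hac⟩ := exists_elliptic_symbol hΓ hv (-k)
  obtain ⟨C, hC⟩ := (hbd _ ha).exists_knapp_bound_of_homogeneous hp
    (Complex.continuous_re.comp ha.1.1.continuous) ha₀ hΓ₀.2.2 hφ hφ_hom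
  obtain ⟨P, hP, Q, hQ, hPQ⟩ := eventually_prod_iff.1 hac
  have hS : Tendsto (fun z => v + S z) (𝓝 0) (𝓝 v) := by
    simpa using (continuous_const.add S.continuous).tendsto (0 : Space) (f := fun z => v + S z)
  have hΓ₀v : ∀ᶠ ξ in 𝓝 v, ξ ∈ Γ₀ := hΓ₀.1.mem_nhds hΓ₀.2.1
  have hnear := (tendsto_anisotropicBox hκ).eventually (hS.eventually (hΓ₀v.and hQ)).smallSets
  set J := |LinearMap.det (S : Space →ₗ[ℝ] Space)| with hJ_def
  have hJ : 0 < J := abs_pos.2 S.toLinearEquiv.isUnit_det'.ne_zero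
  have hbound : ∀ᶠ t in atTop, t ^ ((3 - ∑ i, κ i) * (2 / p.toReal - 1) - k)
      ≤ C / (c * J ^ (2 / p.toReal - 1)) := by
    filter_upwards [tendsto_inv_atTop_nhdsGT_zero.eventually (hbox.and hnear), hP,
      eventually_gt_atTop 0] with t ⟨hφt, hΓt⟩ hPt ht
    have hCt := hC v w S κ (c * t ^ (-k)) (by positivity) t ht fun z hz =>
      ⟨(hΓt z hz).1, hφt z hz, hPQ hPt (hΓt z hz).2⟩
    rw [← hJ_def, Real.mul_rpow hJ.le (by positivity), ← Real.rpow_mul ht.le] at hCt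
    rw [le_div_iff₀ (by positivity), sub_eq_add_neg, Real.rpow_add ht]
    exact le_of_eq_of_le (by ring) hCt
  linarith [nonpos_of_eventually_rpow_le hbound]

/-! ### Level sets given by a graph -/

/-- The horizontal part `(ξ₀, ξ₁)` of a point `ξ` of space. -/
noncomputable def horizontal : Space →L[ℝ] Plane :=
  LinearMap.toContinuousLinearMap
    { toFun ξ := WithLp.toLp 2 fun i => ξ i.castSucc
      map_add' _ _ := rfl
      map_smul' _ _ := rfl }

theorem exists_equiv_horizontal_eq (T : Plane ≃L[ℝ] Plane) :
    ∃ S : Space ≃L[ℝ] Space, ∀ ξ, horizontal (S ξ) = T (horizontal ξ) := by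
  let e : Space ≃L[ℝ] Plane × EuclideanSpace ℝ (Fin 1) :=
    EuclideanSpace.finAddEquivProd (𝕜 := ℝ) (n := 2) (m := 1)
  exact ⟨e.trans ((T.prodCongr (.refl ℝ _)).trans e.symm), fun ξ =>
    congrArg Prod.fst (e.apply_symm_apply (T.prodCongr (.refl ℝ _) (e ξ)))⟩

theorem exists_inner_eq_sub (ℓ : Plane →L[ℝ] ℝ) :
    ∃ w : Space, ∀ ξ : Space, inner ℝ ξ w = ξ 2 - ℓ (horizontal ξ) :=
  ⟨(InnerProductSpace.toDual ℝ Space).symm (EuclideanSpace.proj 2 - ℓ.comp horizontal), fun ξ => by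
    rw [real_inner_comm, InnerProductSpace.toDual_symm_apply]; rfl⟩

theorem smul_mem_anisotropicBox {ι : Type*} {κ : ι → ℝ} {ρ c : ℝ} (hc : |c| ≤ 1)
    {x : EuclideanSpace ℝ ι} (hx : x ∈ anisotropicBox κ ρ) : c • x ∈ anisotropicBox κ ρ := fun i =>
  (abs_mul c (x i)).trans_le ((mul_le_of_le_one_left (abs_nonneg _) hc).trans (hx i))

section Graph

variable {φ : Space → ℝ} {Γ : Set Space} {ϕ : Plane → ℝ}

theorem eq_sub_mul_of_graph (hΓ : ∀ ξ ∈ Γ, ∀ t : ℝ, 0 < t → t • ξ ∈ Γ)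
    (hφ_pos : ∀ ξ ∈ Γ, 0 < φ ξ) (hφ_hom : ∀ ξ ∈ Γ, ∀ t : ℝ, 0 < t → φ (t • ξ) = t * φ ξ)
    (hgraph : ∀ ξ ∈ Γ, φ ξ = 1 → ξ 2 = 1 + ϕ (horizontal ξ)) {ξ : Space} (hξ : ξ ∈ Γ) :
    φ ξ = ξ 2 - φ ξ * ϕ ((φ ξ)⁻¹ • horizontal ξ) := by
  have hs := hφ_pos ξ hξ
  have hs' := inv_pos.2 hs
  have hlevel : (φ ξ)⁻¹ * ξ 2 = 1 + ϕ ((φ ξ)⁻¹ • horizontal ξ) := by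
    simpa only [map_smul, PiLp.smul_apply, smul_eq_mul] using
      hgraph _ (hΓ ξ hξ _ hs') ((hφ_hom ξ hξ _ hs').trans (inv_mul_cancel₀ hs.ne'))
  linear_combination (norm := (field_simp; ring)) -φ ξ * hlevel

theorem eventually_abs_sub_le_of_graph (hΓ : IsConicNhd Γ !₂[0, 0, 1])
    (hφ : ContinuousOn φ Γ) (hφ_pos : ∀ ξ ∈ Γ, 0 < φ ξ)
    (hφ_hom : ∀ ξ ∈ Γ, ∀ t : ℝ, 0 < t → φ (t • ξ) = t * φ ξ)
    (hgraph : ∀ ξ ∈ Γ, φ ξ = 1 → ξ 2 = 1 + ϕ (horizontal ξ)) (hϕ : ϕ 0 = 0)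
    {ℓ : Plane →L[ℝ] ℝ} {w : Space} (hw : ∀ ξ : Space, inner ℝ ξ w = ξ 2 - ℓ (horizontal ξ))
    {T : Plane ≃L[ℝ] Plane} {S : Space ≃L[ℝ] Space}
    (hS : ∀ z, horizontal (S z) = T ((1 / 2 : ℝ) • horizontal z))
    {κ : Fin 3 → ℝ} (hκ : ∀ i, 0 < κ i)
    (hbox : ∀ᶠ ρ in 𝓝[>] 0, ∀ x ∈ anisotropicBox (fun i : Fin 2 => κ i.castSucc) ρ,
      |ϕ (T x) - ℓ (T x)| ≤ 1 / 4 * ρ) :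
    ∀ᶠ ρ in 𝓝[>] 0, ∀ z ∈ anisotropicBox κ ρ,
      |φ (!₂[0, 0, 1] + S z) - inner ℝ (!₂[0, 0, 1] + S z) w| ≤ ρ / 2 := by
  set v : Space := !₂[0, 0, 1]
  have hv_horizontal : horizontal v = 0 := by
    ext i; fin_cases i <;> rfl
  have hφv : φ v = 1 := by
    simpa [hv_horizontal, hϕ, show v 2 = 1 from rfl] using
      eq_sub_mul_of_graph hΓ.2.2 hφ_pos hφ_hom hgraph hΓ.2.1
  have hΓv : ∀ᶠ η in 𝓝 v, η ∈ Γ := hΓ.1.mem_nhds hΓ.2.1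
  have hnear : ∀ᶠ η in 𝓝 v, η ∈ Γ ∧ φ η ∈ Set.Ioo (1 / 2) 2 := hΓv.and <|
    (hφ.continuousAt hΓv).eventually_mem (Ioo_mem_nhds (by norm_num [hφv]) (by norm_num [hφv]))
  have hS₀ : Tendsto (fun z => v + S z) (𝓝 0) (𝓝 v) := by
    simpa using (continuous_const.add S.continuous).tendsto (0 : Space) (f := fun z => v + S z)
  filter_upwards [hbox, (tendsto_anisotropicBox hκ).eventually (hS₀.eventually hnear).smallSets]
    with ρ hρ hρ_near z hz
  obtain ⟨hη, hη_lower, hη_upper⟩ := hρ_near z hz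
  have hs := hφ_pos _ hη
  set s := φ (v + S z)
  have hx : (s⁻¹ * (1 / 2)) • horizontal z ∈ anisotropicBox (fun i : Fin 2 => κ i.castSucc) ρ := by
    refine smul_mem_anisotropicBox ?_ fun i => hz i.castSucc
    rw [abs_of_pos (by positivity), inv_mul_le_one₀ hs]
    exact hη_lower.le
  have hTx : T ((s⁻¹ * (1 / 2)) • horizontal z) = s⁻¹ • horizontal (v + S z) := by
    rw [map_add, hv_horizontal, zero_add, hS, mul_smul, map_smul]
  have hphase : s - inner ℝ (v + S z) w =
      -(s * (ϕ (s⁻¹ • horizontal (v + S z)) - ℓ (s⁻¹ • horizontal (v + S z)))) := by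
    rw [hw, map_smul, smul_eq_mul, mul_sub, mul_inv_cancel_left₀ hs.ne']
    linear_combination eq_sub_mul_of_graph hΓ.2.2 hφ_pos hφ_hom hgraph hη
  rw [hphase, abs_neg, abs_mul, abs_of_pos hs, ← hTx]
  calc s * |ϕ (T _) - ℓ (T _)| ≤ 2 * (1 / 4 * ρ) := by
        gcongr
        exact hρ _ hx
    _ = ρ / 2 := by ring

theorem mul_le_of_lt_newtonDistance (hΓ : IsConicNhd Γ !₂[0, 0, 1])
    (hφ : ContinuousOn φ Γ) (hφ_pos : ∀ ξ ∈ Γ, 0 < φ ξ)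
    (hφ_hom : ∀ ξ ∈ Γ, ∀ t : ℝ, 0 < t → φ (t • ξ) = t * φ ξ)
    (hgraph : ∀ ξ ∈ Γ, φ ξ = 1 → ξ 2 = 1 + ϕ (horizontal ξ)) (hϕ_smooth : ContDiffAt ℝ ∞ ϕ 0)
    (hϕ : ϕ 0 = 0) {Γ' : Set Space} (hΓ' : IsConicNhd Γ' !₂[0, 0, 1]) {p : ℝ≥0∞} (hp : 1 ≤ p)
    {k : ℝ} (hbd : ∀ a ∈ classicalSymbolsIn (-k) Γ', ConvOpBounded φ a p) (ℓ : Plane →L[ℝ] ℝ)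
    (T : Plane ≃L[ℝ] Plane) {d : ℝ} (hd₀ : 0 < d)
    (hd : d < newtonDistance ((fun x => ϕ x - ℓ x) ∘ T)) :
    (3 - 1 / d) * (2 / p.toReal - 1) ≤ k := by
  obtain ⟨d', hdd', hd'⟩ := EReal.lt_iff_exists_real_btwn.1 hd
  replace hdd' : d < d' := EReal.coe_lt_coe_iff.1 hdd'
  obtain ⟨κ, hκ, hκ_sum, m, hm, hκm⟩ := exists_pos_weights_of_lt_newtonDistance (hd₀.trans hdd') hd'
  have hsmooth : ContDiffAt ℝ ∞ ((fun x => ϕ x - ℓ x) ∘ T) 0 :=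
    ContDiffAt.comp 0 (by simpa using hϕ_smooth.sub ℓ.contDiff.contDiffAt) T.contDiff.contDiffAt
  have hbox := eventually_abs_le_mul_on_anisotropicBox hκ hsmooth (by simp [hϕ]) hm hκm
    (by norm_num : (0 : ℝ) < 1 / 4)
  obtain ⟨w, hw⟩ := exists_inner_eq_sub ℓ
  obtain ⟨S, hS⟩ := exists_equiv_horizontal_eq
    ((ContinuousLinearEquiv.smulLeft (Units.mk0 (1 / 2 : ℝ) (by norm_num))).trans T)
  let κ' : Fin 3 → ℝ := Fin.snoc κ (1 / d - 1 / d')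
  have hκ' : ∀ i, 0 < κ' i := by
    refine Fin.lastCases ?_ fun i => ?_
    · simpa only [κ', Fin.snoc_last, sub_pos] using one_div_lt_one_div_of_lt hd₀ hdd'
    · simpa only [κ', Fin.snoc_castSucc] using hκ i
  have hκ'_sum : ∑ i, κ' i = 1 / d := by
    simp only [Fin.sum_univ_castSucc, κ', Fin.snoc_castSucc, Fin.snoc_last, hκ_sum,
      add_sub_cancel]
  have hv : (!₂[0, 0, 1] : Space) ≠ 0 := fun h => one_ne_zero (congrArg (fun ξ : Space => ξ 2) h)
  rw [← hκ'_sum]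
  refine mul_le_of_forall_convOpBounded hv hΓ hφ hφ_hom hΓ' hp hbd hκ'
    (eventually_abs_sub_le_of_graph hΓ hφ hφ_pos hφ_hom hgraph hϕ hw hS hκ' ?_)
  simpa only [κ', Fin.snoc_castSucc, Function.comp_apply] using hbox

end Graph

theorem ereal_sub_div_mul_le_of_forall_lt {h : EReal} (hh : 0 < h) {A B q : ℝ} {k : EReal}
    (H : ∀ d : ℝ, 0 < d → (d : EReal) < h → (((A - B / d) * q : ℝ) : EReal) ≤ k) :
    (A - B / h) * q ≤ k := by
  induction h with
  | bot => exact absurd hh (by simp)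
  | top =>
    have hlim : Tendsto (fun d : ℝ => (((A - B / d) * q : ℝ) : EReal)) atTop
        (𝓝 (((A - 0) * q : ℝ) : EReal)) :=
      (continuous_coe_real_ereal.tendsto _).comp
        ((tendsto_const_nhds.sub (tendsto_const_nhds.div_atTop tendsto_id)).mul_const q)
    simpa [EReal.div_top] using le_of_tendsto hlim
      ((eventually_gt_atTop 0).mono fun d hd => H d hd (EReal.coe_lt_top d))
  | coe s =>
    have hs : 0 < s := EReal.coe_pos.1 hh
    have hcont : ContinuousAt (fun d : ℝ => (((A - B / d) * q : ℝ) : EReal)) s :=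
      continuous_coe_real_ereal.continuousAt.comp
        ((continuousAt_const.sub (continuousAt_const.div continuousAt_id hs.ne')).mul_const q)
    rw [← EReal.coe_div, ← EReal.coe_sub, ← EReal.coe_mul]
    refine le_of_tendsto (hcont.tendsto.mono_left (nhdsWithin_le_nhds (s := Set.Iio s))) ?_
    filter_upwards [self_mem_nhdsWithin, nhdsWithin_le_nhds (lt_mem_nhds hs)] with d hds hd
    exact H d hd (EReal.coe_lt_coe_iff.2 hds)

theorem mainTheorem5_general
    (p : ℝ) (hp : 1 ≤ p)
    (φ : Space → ℝ) (Γ₀ : Set Space) (hΓ₀ : IsConicNhd Γ₀ !₂[0, 0, 1])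
    (hφ_smooth : ContDiffOn ℝ ∞ φ Γ₀)
    (hφ_pos : ∀ ξ ∈ Γ₀, 0 < φ ξ)
    (hφ_hom : ∀ ξ ∈ Γ₀, ∀ t : ℝ, 0 < t → φ (t • ξ) = t * φ ξ)
    (ϕ : Plane → ℝ) (U : Set Plane) (hU : IsOpen U) (h0U : (0 : Plane) ∈ U)
    (hϕ_smooth : ContDiffOn ℝ ∞ ϕ U)
    (hϕ_zero : ϕ 0 = 0)
    (hgraph : {ξ | ξ ∈ Γ₀ ∧ φ ξ = 1} = {ξ | ∃ x ∈ U, ξ = !₂[x 0, x 1, 1 + ϕ x]}) :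
    (6 - 2 / linearHeight (fun x => ϕ x - fderiv ℝ ϕ 0 x)) * ((1 / p - 1 / 2 : ℝ) : EReal)
      ≤ criticalExponent φ !₂[0, 0, 1] p := by
  have hlevel (ξ : Space) (hξ : ξ ∈ Γ₀) (h1 : φ ξ = 1) : ξ 2 = 1 + ϕ (horizontal ξ) := by
    obtain ⟨x, -, rfl⟩ := hgraph.subset ⟨hξ, h1⟩
    have hx : horizontal !₂[x 0, x 1, 1 + ϕ x] = x := by
      ext i; fin_cases i <;> rfl
    rw [hx]
    rfl
  refine le_iInf₂ fun k ⟨_, Γ, hΓ, _, hbd⟩ =>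
    ereal_sub_div_mul_le_of_forall_lt (linearHeight_pos _) fun d hd₀ hd => ?_
  obtain ⟨T, hT⟩ := lt_iSup_iff.1 hd
  have h := mul_le_of_lt_newtonDistance hΓ₀ hφ_smooth.continuousOn hφ_pos hφ_hom hlevel
    (hϕ_smooth.contDiffAt (hU.mem_nhds h0U)) hϕ_zero hΓ (ENNReal.one_le_ofReal.2 hp) hbd
    (fderiv ℝ ϕ 0) T hd₀ hT
  rw [ENNReal.toReal_ofReal (zero_le_one.trans hp)] at h
  exact EReal.coe_le_coe_iff.2 (h.trans_eq' (by ring))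

theorem mainTheorem5
    (p : ℝ) (hp₁ : 1 ≤ p) (hp₂ : p ≤ 2)
    (φ : Space → ℝ) (Γ₀ : Set Space) (hΓ₀ : IsConicNhd Γ₀ !₂[0, 0, 1])
    (hφ_smooth : ContDiffOn ℝ ∞ φ Γ₀)
    (hφ_pos : ∀ ξ ∈ Γ₀, 0 < φ ξ)
    (hφ_hom : ∀ ξ ∈ Γ₀, ∀ t : ℝ, 0 < t → φ (t • ξ) = t * φ ξ)
    (ϕ : Plane → ℝ) (U : Set Plane) (hU : IsOpen U) (h0U : (0 : Plane) ∈ U)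
    (hϕ_smooth : ContDiffOn ℝ ∞ ϕ U)
    (hϕ_zero : ϕ 0 = 0) (hϕ_grad : fderiv ℝ ϕ 0 = 0)
    (hgraph : {ξ | ξ ∈ Γ₀ ∧ φ ξ = 1} = {ξ | ∃ x ∈ U, ξ = !₂[x 0, x 1, 1 + ϕ x]}) :
    (6 - 2 / linearHeight ϕ) * ((1 / p - 1 / 2 : ℝ) : EReal)
      ≤ criticalExponent φ !₂[0, 0, 1] p := by
  simpa [hϕ_grad] using mainTheorem5_general p hp₁ φ Γ₀ hΓ₀ hφ_smooth hφ_pos hφ_hom ϕ U hU h0U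
    hϕ_smooth hϕ_zero hgraph
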